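/- Let $\Gamma$ be either the unit circle $S^1=\{z\in\mathbb C: |z|=1\}$ or, for some integer $m\ge 1$, the cyclic group of order $m$ generated by $e^{2\pi i/m}$. Let $G=(V,E)$ be a finite simple graph on $N$ vertices with positive symmetric edge weights $w_{uv}=w_{vu}$, a positive vertex measure $\mu:V\to(0,\infty)$, and a $\Gamma$-valued signature $\sigma$, i.e. $\sigma_{uv}\in\Gamma$ for every oriented edge $(u,v)$, with $\sigma_{vu}=\sigma_{uv}^{-1}$. Put $$d_\mu=\max_{u\in V}\frac{1}{\mu(u)}\sum_{v\sim u}w_{uv},\qquad \mathrm{vol}_\mu(X)=\sum_{u\in X}\mu(u),\qquad |E(X,X^c)|=\sum_{u\in X}\ \sum_{v\in X^c,\,v\sim u}w_{uv}\qquad(X\subseteq V),$$ and for nonempty $X\subseteq V$ let $$\iota^\sigma(X)=\min_{\tau:X\to\Gamma}\ \sum_{\{u,v\}\in E,\ u,v\in X}w_{uv}\,|\tau(u)-\sigma_{uv}\tau(v)|$$ be the frustration index. Say that $(G,\sigma)$ has isoperimetric dimension $\delta$ with isoperimetric constant $c_\delta$ if $$\iota^\sigma(X)+|E(X,X^c)|\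 \ge\ c_\delta\,\mathrm{vol}_\mu(X)^{(\delta-1)/\delta}\qquad\text{for every nonempty }X\subseteq V.$$ Let $\lambda_1\le\lambda_2\le\dots\le\lambda_N$ be the eigenvalues, listed with multiplicity, of the magnetic Laplacian $$\Delta_\sigma f(u)=\frac1{\sqrt{\mu(u)}}\sum_{v\sim u}w_{uv}\left(\frac{f(u)}{\sqrt{\mu(u)}}-\sigma_{uv}\frac{f(v)}{\sqrt{\mu(v)}}\right),\qquad f:V\to\mathbb C.$$ Suppose that $(G,\sigma)$ has isoperimetric dimension $\delta>2$ with isoperimetric constant $c_\delta>0$. Then there is a constant $C'_\delta>0$, depending only on $\delta$, $c_\delta$ and $d_\mu$, such that for every $k\in\{1,\dots,N\}$ $$\lambda_k\ \ge\ C'_\delta\left(\frac{k}{\mathrm{vol}_\mu(G)}\right)^{2/\delta}\qquad\text{and}\qquad \lambda_k\ \ge\ C'_\delta\,\frac{k}{\mathrm{vol}_\mu(G)},$$ where $\mathrm{vol}_\mu(G)=\mathrm{vol}_\mu(V)$. -/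

import Mathlib

/-- The signature groups: the whole unit circle, or, for some `m ≥ 1`, the cyclic group of order `m`
generated by the primitive root of unity `exp (2πi/m)`. -/
def IsSignatureGroup (Γ : Subgroup Circle) : Prop :=
  Γ = ⊤ ∨ ∃ m : ℕ, 1 ≤ m ∧ Γ = Subgroup.zpowers (Circle.exp (2 * Real.pi / m))

/-- A simple graph on `V` with positive symmetric edge weights, a positive vertex measure, and a
`Γ`-valued signature on oriented edges. The values of `w` and `s` at pairs that are not
edges are irrelevant: no definition below depends on them. -/
structure MagneticGraph (V : Type*) (Γ : Subgroup Circle) where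
  graph : SimpleGraph V
  w : V → V → ℝ
  w_pos : ∀ u v, graph.Adj u v → 0 < w u v
  w_symm : ∀ u v, graph.Adj u v → w v u = w u v
  μ : V → ℝ
  μ_pos : ∀ u, 0 < μ u
  s : V → V → Γ
  s_inv : ∀ u v, graph.Adj u v → s v u = (s u v)⁻¹

namespace MagneticGraph

noncomputable section

variable {V : Type*} {Γ : Subgroup Circle}

/-- The signature as a complex number of modulus one. -/
def sig (G : MagneticGraph V Γ) (u v : V) : ℂ := ((G.s u v : Circle) : ℂ)

open scoped Classical in
/-- The edge weight, extended by `0` to pairs of vertices that are not joined by an edge. -/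
def weight (G : MagneticGraph V Γ) (u v : V) : ℝ := if G.graph.Adj u v then G.w u v else 0

variable [Fintype V]

/-- The weighted degree `d_u`. -/
def wdegree (G : MagneticGraph V Γ) (u : V) : ℝ := ∑ v, G.weight u v

/-- The maximal `μ`-degree `d_μ = max_u d_u / μ(u)`. -/
def maxDegree (G : MagneticGraph V Γ) : ℝ := ⨆ u, G.wdegree u / G.μ u

open scoped Classical in
/-- The boundary measure `|E(X, Xᶜ)|`. -/
def boundary (G : MagneticGraph V Γ) (X : Finset V) : ℝ := ∑ u ∈ X, ∑ v ∈ Xᶜ, G.weight u v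

/-- The `μ`-volume of a set of vertices. -/
def vol (G : MagneticGraph V Γ) (X : Finset V) : ℝ := ∑ u ∈ X, G.μ u

/-- The frustration index of `X`: the minimum over `τ : X → Γ` of
`∑ w_uv |τ(u) - s_uv τ(v)|`, the sum being over the (unordered) edges `{u,v}` inside `X`.
The double sum counts each edge twice, hence the factor `1/2`. For the signature groups above,
`X → Γ` is compact and the infimum is attained. -/
def frustrationIndex (G : MagneticGraph V Γ) (X : Finset V) : ℝ :=
  ⨅ τ : X → Γ, (1 / 2 : ℝ) * ∑ u : X, ∑ v : X,
    G.weight u v * ‖((τ u : Circle) : ℂ) - G.sig u v * ((τ v : Circle) : ℂ)‖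

/-- `(G, s)` has isoperimetric dimension `δ` with isoperimetric constant `c`. -/
def HasIsoperimetricDimension (G : MagneticGraph V Γ) (δ c : ℝ) : Prop :=
  ∀ X : Finset V, X.Nonempty →
    c * G.vol X ^ ((δ - 1) / δ) ≤ G.frustrationIndex X + G.boundary X

/-- The (normalized) magnetic Laplacian, acting on functions `f : V → ℂ`. -/
def laplacian (G : MagneticGraph V Γ) : (V → ℂ) →ₗ[ℂ] (V → ℂ) where
  toFun f u := 1 / (√(G.μ u) : ℂ) *
    ∑ v, (G.weight u v : ℂ) * (f u / (√(G.μ u) : ℂ) - G.sig u v * (f v / (√(G.μ v) : ℂ)))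
  map_add' f g := by
    funext u
    simp only [Pi.add_apply, ← mul_add, ← Finset.sum_add_distrib]
    congr 1
    refine Finset.sum_congr rfl fun v _ => ?_
    ring
  map_smul' a f := by
    funext u
    simp only [Pi.smul_apply, smul_eq_mul, RingHom.id_apply, Finset.mul_sum]
    refine Finset.sum_congr rfl fun v _ => ?_
    ring

open scoped Classical in
/-- The matrix of the magnetic Laplacian in the standard basis. -/
def laplacianMatrix (G : MagneticGraph V Γ) : Matrix V V ℂ := LinearMap.toMatrix' G.laplacian

theorem laplacianMatrix_apply_ne (G : MagneticGraph V Γ) {u v : V} (h : u ≠ v) :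
    G.laplacianMatrix u v =
      -(1 / (√(G.μ u) : ℂ) * ((G.weight u v : ℂ) * (G.sig u v * (1 / (√(G.μ v) : ℂ))))) := by
  classical
  have h1 : ∀ x : V, (G.weight u x : ℂ) * ((Pi.single v (1 : ℂ) : V → ℂ) u / (√(G.μ u) : ℂ) -
      G.sig u x * ((Pi.single v (1 : ℂ) : V → ℂ) x / (√(G.μ x) : ℂ))) =
      if x = v then -((G.weight u v : ℂ) * (G.sig u v * (1 / (√(G.μ v) : ℂ)))) else 0 := by
    intro x
    by_cases hx : x = v
    · subst hx
      simp [h]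
    · simp [h, hx]
  have h2 : G.laplacianMatrix u v = G.laplacian (Pi.single v 1) u := by
    rw [laplacianMatrix, LinearMap.toMatrix'_apply]
  rw [h2]
  simp only [laplacian, LinearMap.coe_mk, AddHom.coe_mk, h1]
  simp

theorem laplacianMatrix_apply_self (G : MagneticGraph V Γ) (u : V) :
    G.laplacianMatrix u u =
      1 / (√(G.μ u) : ℂ) * ((G.wdegree u : ℂ) * (1 / (√(G.μ u) : ℂ))) := by
  classical
  have h1 : ∀ x : V, (G.weight u x : ℂ) * ((Pi.single u (1 : ℂ) : V → ℂ) u / (√(G.μ u) : ℂ) -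
      G.sig u x * ((Pi.single u (1 : ℂ) : V → ℂ) x / (√(G.μ x) : ℂ))) =
      (G.weight u x : ℂ) * (1 / (√(G.μ u) : ℂ)) := by
    intro x
    by_cases hx : x = u
    · subst hx
      simp [weight]
    · simp [hx]
  have h2 : G.laplacianMatrix u u = G.laplacian (Pi.single u 1) u := by
    rw [laplacianMatrix, LinearMap.toMatrix'_apply]
  rw [h2]
  simp only [laplacian, LinearMap.coe_mk, AddHom.coe_mk, h1]
  rw [← Finset.sum_mul, wdegree]
  push_cast
  rfl

theorem laplacianMatrix_isHermitian (G : MagneticGraph V Γ) : G.laplacianMatrix.IsHermitian := by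
  refine Matrix.IsHermitian.ext fun u v => ?_
  by_cases h : u = v
  · subst h
    simp [laplacianMatrix_apply_self]
  · rw [laplacianMatrix_apply_ne G h, laplacianMatrix_apply_ne G (Ne.symm h)]
    by_cases ha : G.graph.Adj u v
    · have hw : G.weight v u = G.weight u v := by
        simp [weight, ha, ha.symm, G.w_symm u v ha]
      have hs : star (G.sig v u) = G.sig u v := by
        rw [sig, sig, G.s_inv u v ha, Subgroup.coe_inv, Circle.coe_inv_eq_conj]
        simp
      simp only [RCLike.star_def] at hs
      simp [hw, hs]
      ring
    · have ha' : ¬ G.graph.Adj v u := fun h' => ha h'.symm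
      simp [weight, ha, ha']

open scoped Classical in
/-- The eigenvalues of the magnetic Laplacian, listed with multiplicity in non-decreasing order.
The numbering starts at `0`, so that `G.eigenvalue k` is `λ_{k+1}`
(Mathlib's `eigenvalues₀` is listed in non-increasing order, hence `Fin.rev`). -/
def eigenvalue (G : MagneticGraph V Γ) (k : Fin (Fintype.card V)) : ℝ :=
  G.laplacianMatrix_isHermitian.eigenvalues₀ k.rev

theorem eigenvalue_monotone (G : MagneticGraph V Γ) : Monotone G.eigenvalue := by
  classical
  intro i j h
  exact G.laplacianMatrix_isHermitian.eigenvalues₀_antitone (Fin.rev_le_rev.mpr h)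

end

end MagneticGraph

/-! ### Randomized rounding of phases to a cyclic signature group -/

open MeasureTheory

/-! The chain is: isoperimetry, Sobolev, Nash, heat kernel decay, eigenvalue bound. Write `f` in
polar form and apply the isoperimetric inequality to each level set `{t ≤ ‖f‖}`, with the phase of
`f` as competitor in the frustration index. These phases need not lie in `Γ`; if `Γ` is cyclic they
are rounded with a random offset, which costs a factor `π / 2` on average
(`frustrationIndex_le_of_phase`). Integrating over `t` gives an L¹ Sobolev inequality for the
magnetic gradient (`sum_mul_norm_le`). Inserting `‖h‖ ^ s * h` with `s = δ / (δ - 2)` and using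
Cauchy–Schwarz gives the L² version (`sobolev`), and interpolation with the L¹ norm gives `nash`.

Let `d` be the maximal degree. The lazy walk `1 - Δ / (2d)`, read in the measure `μ`, contracts L¹
and loses at least `energy / (2d)` of the squared L² norm per step. By Nash, the squared norm of the
walk started at a normalized point mass satisfies `a (n+1) ≤ a n - C * a n ^ (1 + 2/δ)`, so it is
`O(n ^ (-δ/2))`. Summed over starting points this bounds a trace: `∑ (1 - λ_i / (2d)) ^ (2n)` is at
most a constant times `vol * n ^ (-δ/2)` (`sum_eigenvalue_pow_le`). If `λ_k ≤ d`, keeping the first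
`k` terms and taking `n` of order `d / λ_k` gives the first bound.

Isoperimetry of single vertices bounds `μ` below, whence `k / vol ≤ (d / c) ^ δ`. This settles the
case `λ_k > d` and converts the exponent `2 / δ` into `1`, which is the second bound. -/

theorem integral_floor_add (x : ℝ) :
    IntervalIntegrable (fun t : ℝ => (⌊x + t⌋ : ℝ)) volume 0 1 ∧
      ∫ t in (0 : ℝ)..1, (⌊x + t⌋ : ℝ) = x := by
  have hmono : Monotone (fun t : ℝ => (⌊x + t⌋ : ℝ)) := fun a b h => by
    have : ⌊x + a⌋ ≤ ⌊x + b⌋ := Int.floor_mono (by linarith)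
    exact Int.cast_le.mpr this
  have hi : ∀ a b, IntervalIntegrable (fun t : ℝ => (⌊x + t⌋ : ℝ)) volume a b :=
    fun a b => hmono.intervalIntegrable
  refine ⟨hi _ _, ?_⟩
  have h0 := Int.fract_nonneg x
  have h1 := Int.fract_lt_one x
  have h2 := Int.floor_add_fract x
  rw [← intervalIntegral.integral_add_adjacent_intervals (hi 0 (1 - Int.fract x)) (hi _ 1)]
  have e1 : ∫ t in (0 : ℝ)..(1 - Int.fract x), (⌊x + t⌋ : ℝ) =
      ∫ t in (0 : ℝ)..(1 - Int.fract x), (⌊x⌋ : ℝ) := by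
    refine intervalIntegral.integral_congr_ae ?_
    -- The floor jumps exactly at `t = 1 - fract x`, an endpoint that the half-open interval
    -- contains.
    have : ∀ᵐ t : ℝ, t ≠ 1 - Int.fract x := by
      simp [ae_iff]
    filter_upwards [this] with t ht hm
    rw [Set.uIoc_of_le (by linarith)] at hm
    have : t < 1 - Int.fract x := lt_of_le_of_ne hm.2 ht
    have : ⌊x + t⌋ = ⌊x⌋ := by
      rw [Int.floor_eq_iff]
      exact ⟨by linarith [hm.1], by linarith⟩
    rw [this]
  have e2 : ∫ t in (1 - Int.fract x)..1, (⌊x + t⌋ : ℝ) =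
      ∫ t in (1 - Int.fract x)..1, ((⌊x⌋ : ℝ) + 1) := by
    refine intervalIntegral.integral_congr_ae ?_
    refine Filter.Eventually.of_forall fun t hm => ?_
    rw [Set.uIoc_of_le (by linarith)] at hm
    have : ⌊x + t⌋ = ⌊x⌋ + 1 := by
      rw [Int.floor_eq_iff]
      push_cast
      exact ⟨by linarith [hm.1], by linarith [hm.2]⟩
    rw [this]
    push_cast
    ring
  rw [e1, e2]
  simp only [intervalIntegral.integral_const, smul_eq_mul]
  linear_combination h2

/-- The phase `α` rounded to a power of `exp (2πi/m)`, with offset `t`. -/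
noncomputable def roundPhase (m : ℕ) (t α : ℝ) : Circle :=
  Circle.exp (2 * Real.pi / m) ^ ⌊m * α / (2 * Real.pi) + t⌋

theorem measurable_roundPhase (m : ℕ) (α : ℝ) : Measurable fun t => (roundPhase m t α : ℂ) := by
  unfold roundPhase
  exact (measurable_of_countable
    fun n : ℤ => ((Circle.exp (2 * Real.pi / m) ^ n : Circle) : ℂ)).comp
    (Int.measurable_floor.comp (measurable_const.add measurable_id))

theorem norm_coe_sub_le_two (x y : Circle) : ‖(x : ℂ) - y‖ ≤ 2 := by
  refine (norm_sub_le _ _).trans ?_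
  simp only [Circle.norm_coe]
  norm_num

theorem intervalIntegrable_roundPhase_sub (m : ℕ) (α β : ℝ) :
    IntervalIntegrable (fun t => ‖(roundPhase m t α : ℂ) - roundPhase m t β‖) volume 0 1 := by
  refine (intervalIntegrable_const (c := (2 : ℝ))).mono_fun ?_ ?_
  · exact ((measurable_roundPhase m α).sub
      (measurable_roundPhase m β)).norm.aestronglyMeasurable
  · refine Filter.Eventually.of_forall fun t => ?_
    simpa using norm_coe_sub_le_two _ _

theorem norm_exp_sub_le (a b : ℝ) : ‖(Circle.exp a : ℂ) - Circle.exp b‖ ≤ |a - b| := by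
  have h : (Circle.exp a : ℂ) - Circle.exp b =
      Circle.exp b * (Complex.exp (Complex.I * ((a - b : ℝ) : ℂ)) - 1) := by
    rw [mul_sub, mul_one, Circle.coe_exp, Circle.coe_exp, ← Complex.exp_add]
    congr 2
    push_cast
    ring
  rw [h, norm_mul, Circle.norm_coe, one_mul]
  exact Real.norm_exp_I_mul_ofReal_sub_one_le

theorem norm_exp_zpow_sub_le (a : ℝ) (i j : ℤ) :
    ‖((Circle.exp a ^ i : Circle) : ℂ) - ((Circle.exp a ^ j : Circle) : ℂ)‖ ≤
      |a| * |(i : ℝ) - j| := by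
  rw [← Circle.exp_intCast_mul, ← Circle.exp_intCast_mul]
  refine (norm_exp_sub_le _ _).trans_eq ?_
  rw [← sub_mul, abs_mul, mul_comm]

theorem roundPhase_add_two_pi {m : ℕ} (hm : 1 ≤ m) (t α : ℝ) (n : ℤ) :
    roundPhase m t (α + n * (2 * Real.pi)) = roundPhase m t α := by
  have hm' : (m : ℝ) ≠ 0 := by positivity
  have hp := Real.pi_pos.ne'
  have : (m * (α + n * (2 * Real.pi)) / (2 * Real.pi) + t : ℝ) =
      m * α / (2 * Real.pi) + t + ((m * n : ℤ) : ℝ) := by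
    push_cast
    field_simp
    ring
  rw [roundPhase, this, Int.floor_add_intCast, zpow_add, zpow_mul, ← Circle.exp_intCast_mul _ (m : ℤ),
    Int.cast_natCast]
  have h : (m : ℝ) * (2 * Real.pi / m) = 2 * Real.pi := by field_simp
  rw [h]
  simp [roundPhase]

/-- Rounding is equivariant under the cyclic group, so signature values can be moved inside it. -/
theorem roundPhase_add_mul {m : ℕ} (hm : 1 ≤ m) (t α : ℝ) (j : ℤ) :
    roundPhase m t (α + j * (2 * Real.pi / m)) =
      Circle.exp (2 * Real.pi / m) ^ j * roundPhase m t α := by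
  have hm' : (m : ℝ) ≠ 0 := by positivity
  have hp := Real.pi_pos.ne'
  have : (m * (α + j * (2 * Real.pi / m)) / (2 * Real.pi) + t : ℝ) =
      m * α / (2 * Real.pi) + t + (j : ℝ) := by
    field_simp
    ring
  rw [roundPhase, this, Int.floor_add_intCast, add_comm, zpow_add, roundPhase]

/-- For a fixed offset rounding is monotone, so the distance of the rounded phases is at most a
signed difference of floors; averaging the floors over the offset recovers the unrounded values
exactly. -/
theorem integral_roundPhase_sub_le_abs {m : ℕ} (hm : 1 ≤ m) (α β : ℝ) :
    ∫ t in (0 : ℝ)..1, ‖(roundPhase m t α : ℂ) - roundPhase m t β‖ ≤ |α - β| := by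
  wlog h : β ≤ α generalizing α β
  · rw [abs_sub_comm]
    simpa only [norm_sub_rev] using this β α (le_of_not_ge h)
  have hm' : (0 : ℝ) < m := by positivity
  have hp := Real.pi_pos
  set x := m * α / (2 * Real.pi) with hx
  set y := m * β / (2 * Real.pi) with hy
  have hxy : y ≤ x := by rw [hx, hy]; gcongr
  have hi := ((integral_floor_add x).1.sub (integral_floor_add y).1).const_mul (2 * Real.pi / m)
  calc ∫ t in (0 : ℝ)..1, ‖(roundPhase m t α : ℂ) - roundPhase m t β‖
      ≤ ∫ t in (0 : ℝ)..1, 2 * Real.pi / m * ((⌊x + t⌋ : ℝ) - ⌊y + t⌋) := by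
        refine intervalIntegral.integral_mono_on zero_le_one
          (intervalIntegrable_roundPhase_sub m α β) hi fun t _ => ?_
        refine (norm_exp_zpow_sub_le _ _ _).trans_eq ?_
        rw [abs_of_pos (by positivity), abs_of_nonneg]
        have : ⌊y + t⌋ ≤ ⌊x + t⌋ := Int.floor_mono (by linarith)
        rw [sub_nonneg]
        exact_mod_cast this
    _ = 2 * Real.pi / m * (x - y) := by
        rw [intervalIntegral.integral_const_mul, intervalIntegral.integral_sub
          (integral_floor_add x).1 (integral_floor_add y).1, (integral_floor_add x).2,
          (integral_floor_add y).2]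
    _ = |α - β| := by
        rw [abs_of_nonneg (by linarith), hx, hy]
        field_simp

theorem integral_roundPhase_sub_le {m : ℕ} (hm : 1 ≤ m) (α β : ℝ) :
    ∫ t in (0 : ℝ)..1, ‖(roundPhase m t α : ℂ) - roundPhase m t β‖ ≤
      Real.pi / 2 * ‖(Circle.exp α : ℂ) - Circle.exp β‖ := by
  have h1 := Complex.angle_le_mul_norm_sub (x := (Circle.exp α : ℂ)) (y := Circle.exp β)
    (Circle.norm_coe _) (Circle.norm_coe _)
  refine le_trans ?_ h1
  rw [Circle.coe_exp, Circle.coe_exp, Complex.angle_exp_exp]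
  have h2 := self_sub_toIocDiv_zsmul Real.two_pi_pos (-Real.pi) (α - β)
  rw [← h2, zsmul_eq_mul]
  -- Shifting `β` by full turns makes `|α - β|` the true angle, which is at most `π / 2` times the
  -- chord.
  have h3 : ∀ t, roundPhase m t β = roundPhase m t
      (β + toIocDiv Real.two_pi_pos (-Real.pi) (α - β) * (2 * Real.pi)) :=
    fun t => (roundPhase_add_two_pi hm t β _).symm
  simp only [h3]
  refine (integral_roundPhase_sub_le_abs hm _ _).trans_eq ?_
  congr 1
  ring

namespace MagneticGraph

variable {V : Type*} {Γ : Subgroup Circle} (G : MagneticGraph V Γ)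

theorem weight_nonneg (u v : V) : 0 ≤ G.weight u v := by
  unfold weight
  split_ifs with h
  · exact (G.w_pos u v h).le
  · exact le_rfl

theorem weight_comm (u v : V) : G.weight u v = G.weight v u := by
  by_cases h : G.graph.Adj u v
  · simp [weight, h, h.symm, G.w_symm u v h]
  · have h' : ¬ G.graph.Adj v u := fun h' => h h'.symm
    simp [weight, h, h']

theorem weight_self (u : V) : G.weight u u = 0 := by simp [weight]

theorem norm_sig (u v : V) : ‖G.sig u v‖ = 1 := Circle.norm_coe _

theorem sig_swap {u v : V} (h : G.graph.Adj u v) :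
    G.sig v u = (starRingEnd ℂ) (G.sig u v) := by
  rw [sig, sig, G.s_inv u v h, Subgroup.coe_inv, Circle.coe_inv_eq_conj]

theorem frustrationIndex_le (X : Finset V) (τ : X → Γ) :
    G.frustrationIndex X ≤ (1 / 2 : ℝ) * ∑ u : X, ∑ v : X,
      G.weight u v * ‖((τ u : Circle) : ℂ) - G.sig u v * ((τ v : Circle) : ℂ)‖ := by
  refine ciInf_le ⟨0, ?_⟩ τ
  rintro _ ⟨τ, rfl⟩
  exact mul_nonneg (by norm_num) (Finset.sum_nonneg fun u _ => Finset.sum_nonneg fun v _ =>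
    mul_nonneg (G.weight_nonneg u v) (norm_nonneg _))

/-- Up to a factor `π / 2`, arbitrary phases do not beat `Γ`-valued ones. -/
theorem frustrationIndex_le_of_phase (hΓ : IsSignatureGroup Γ) (X : Finset V) (α : V → ℝ) :
    G.frustrationIndex X ≤ Real.pi / 2 * ((1 / 2 : ℝ) * ∑ u ∈ X, ∑ v ∈ X,
      G.weight u v * ‖(Circle.exp (α u) : ℂ) - G.sig u v * Circle.exp (α v)‖) := by
  have hw := G.weight_nonneg
  rcases hΓ with rfl | ⟨m, hm, rfl⟩
  · refine (G.frustrationIndex_le X fun u => ⟨Circle.exp (α u), trivial⟩).trans ?_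
    -- For the whole circle the phases are themselves admissible; the factor only keeps the two
    -- cases uniform.
    have h1 : 1 ≤ Real.pi / 2 := by linarith [Real.pi_gt_three]
    rw [← Finset.sum_coe_sort X]
    simp_rw [← Finset.sum_coe_sort X]
    refine le_mul_of_one_le_left ?_ h1
    exact mul_nonneg (by norm_num) (Finset.sum_nonneg fun u _ => Finset.sum_nonneg fun v _ =>
      mul_nonneg (hw u v) (norm_nonneg _))
  · have hj : ∀ u v, ∃ j : ℤ, Circle.exp (2 * Real.pi / m) ^ j = (G.s u v : Circle) :=
      fun u v => Subgroup.mem_zpowers_iff.mp (G.s u v).2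
    choose j hj using hj
    have hsig : ∀ u v a, G.sig u v * (Circle.exp a : ℂ) =
        Circle.exp (a + j u v * (2 * Real.pi / m)) := by
      intro u v a
      rw [sig, ← hj, ← Circle.exp_intCast_mul, Circle.exp_add, mul_comm, Circle.coe_mul]
    have hround : ∀ u v t a, G.sig u v * (roundPhase m t a : ℂ) =
        roundPhase m t (a + j u v * (2 * Real.pi / m)) := by
      intro u v t a
      rw [sig, ← hj, roundPhase_add_mul hm, Circle.coe_mul]
    -- Every offset yields an admissible competitor, so the index is at most the average over
    -- offsets.
    have key : ∀ t : ℝ, G.frustrationIndex X ≤ (1 / 2 : ℝ) * ∑ u ∈ X, ∑ v ∈ X,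
        G.weight u v * ‖(roundPhase m t (α u) : ℂ) -
          roundPhase m t (α v + j u v * (2 * Real.pi / m))‖ := by
      intro t
      refine (G.frustrationIndex_le X fun u =>
        ⟨roundPhase m t (α u), Subgroup.zpow_mem_zpowers _ _⟩).trans_eq ?_
      rw [← Finset.sum_coe_sort X]
      simp_rw [← Finset.sum_coe_sort X, ← hround]
    have hint : ∀ u v, IntervalIntegrable (fun t => G.weight u v * ‖(roundPhase m t (α u) : ℂ) -
        roundPhase m t (α v + j u v * (2 * Real.pi / m))‖) volume 0 1 :=
      fun u v => (intervalIntegrable_roundPhase_sub m _ _).const_mul _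
    have hint1 : ∀ u, IntervalIntegrable (fun t => ∑ v ∈ X, G.weight u v *
        ‖(roundPhase m t (α u) : ℂ) -
          roundPhase m t (α v + j u v * (2 * Real.pi / m))‖) volume 0 1 := fun u => by
      simpa only [Finset.sum_fn] using IntervalIntegrable.sum X fun v _ => hint u v
    have hint2 : IntervalIntegrable (fun t => ∑ u ∈ X, ∑ v ∈ X, G.weight u v *
        ‖(roundPhase m t (α u) : ℂ) -
          roundPhase m t (α v + j u v * (2 * Real.pi / m))‖) volume 0 1 := by
      simpa only [Finset.sum_fn] using IntervalIntegrable.sum X fun u _ => hint1 u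
    have hmono := intervalIntegral.integral_mono_on zero_le_one
      (intervalIntegrable_const (c := G.frustrationIndex X)) (hint2.const_mul (1 / 2 : ℝ))
      fun t _ => key t
    rw [intervalIntegral.integral_const, sub_zero, one_smul] at hmono
    refine hmono.trans ?_
    rw [intervalIntegral.integral_const_mul, mul_left_comm (Real.pi / 2)]
    refine mul_le_mul_of_nonneg_left ?_ (by norm_num)
    rw [intervalIntegral.integral_finsetSum fun u _ => hint1 u, Finset.mul_sum]
    refine Finset.sum_le_sum fun u _ => ?_
    rw [intervalIntegral.integral_finsetSum fun v _ => hint u v, Finset.mul_sum]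
    refine Finset.sum_le_sum fun v _ => ?_
    rw [intervalIntegral.integral_const_mul, mul_left_comm, hsig]
    exact mul_le_mul_of_nonneg_left (integral_roundPhase_sub_le hm _ _) (hw u v)

end MagneticGraph

/-! ### Layer-cake integral and inequalities for complex numbers -/

theorem integral_ite_le {a T : ℝ} (ha : 0 ≤ a) (haT : a ≤ T) :
    IntervalIntegrable (fun t : ℝ => if t ≤ a then (1 : ℝ) else 0) volume 0 T ∧
      ∫ t in (0 : ℝ)..T, (if t ≤ a then (1 : ℝ) else 0) = a := by
  constructor
  · refine Antitone.intervalIntegrable fun x y h => ?_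
    split_ifs with h1 h2
    · exact le_rfl
    · exact absurd (h.trans h1) h2
    · exact zero_le_one
    · exact le_rfl
  · have := intervalIntegral.integral_indicator (f := fun _ => (1 : ℝ)) (μ := volume)
      (a₁ := 0) (a₂ := a) (a₃ := T) ⟨ha, haT⟩
    simpa [Set.indicator_apply] using this

theorem min_mul_norm_sub_le {x y : ℂ} (hx : ‖x‖ = 1) (hy : ‖y‖ = 1) {r s : ℝ} (hr : 0 ≤ r)
    (hs : 0 ≤ s) : min r s * ‖x - y‖ ≤ ‖(r : ℂ) * x - s * y‖ := by
  wlog h : r ≤ s generalizing r s x y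
  · rw [min_comm, norm_sub_rev x, norm_sub_rev ((r : ℂ) * x)]
    exact this hy hx hs hr (le_of_not_ge h)
  rw [min_eq_left h]
  refine le_of_sq_le_sq ?_ (norm_nonneg _)
  have hx2 : x.re ^ 2 + x.im ^ 2 = 1 := by
    have := Complex.sq_norm x
    rw [hx, Complex.normSq_apply] at this
    linarith
  have hy2 : y.re ^ 2 + y.im ^ 2 = 1 := by
    have := Complex.sq_norm y
    rw [hy, Complex.normSq_apply] at this
    linarith
  have hxy : x.re * y.re + x.im * y.im ≤ 1 := by
    nlinarith [sq_nonneg (x.re - y.re), sq_nonneg (x.im - y.im)]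
  rw [mul_pow, Complex.sq_norm, Complex.sq_norm, Complex.normSq_apply, Complex.normSq_apply]
  simp only [Complex.sub_re, Complex.sub_im, Complex.re_ofReal_mul, Complex.im_ofReal_mul]
  -- This product is the difference of the two squared norms.
  have h1 : 0 ≤ (s - r) * (s + r - 2 * r * (x.re * y.re + x.im * y.im)) := by
    refine mul_nonneg (sub_nonneg.mpr h) ?_
    nlinarith [mul_le_mul_of_nonneg_left hxy hr]
  linear_combination h1 - (s ^ 2 - r ^ 2) * hy2

/-- Bernoulli's inequality for `(y / x) ^ s`, followed by `y ≤ x`. -/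
theorem rpow_sub_rpow_mul_le {x y s : ℝ} (hy : 0 ≤ y) (hyx : y ≤ x) (hs : 1 ≤ s) :
    (x ^ s - y ^ s) * y ≤ s * x ^ s * (x - y) := by
  rcases hy.eq_or_lt with rfl | hy
  · rw [mul_zero]
    have : 0 ≤ x ^ s := Real.rpow_nonneg hyx s
    exact mul_nonneg (mul_nonneg (by linarith) this) (by linarith)
  have hx : 0 < x := hy.trans_le hyx
  have h := one_add_mul_self_le_rpow_one_add (s := y / x - 1)
    (by linarith [div_pos hy hx]) hs
  rw [add_sub_cancel, Real.div_rpow hy.le hx.le, le_div_iff₀ (by positivity)] at h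
  have hxs : 0 < x ^ s := by positivity
  have h2 : x ^ s - y ^ s ≤ s * x ^ s * ((x - y) / x) := by
    have : (x - y) / x = 1 - y / x := by field_simp
    rw [this]
    linarith
  calc (x ^ s - y ^ s) * y ≤ s * x ^ s * ((x - y) / x) * y := by gcongr
    _ = s * x ^ s * (x - y) * (y / x) := by ring
    _ ≤ s * x ^ s * (x - y) * 1 := by
        have : 0 ≤ s * x ^ s * (x - y) :=
          mul_nonneg (mul_nonneg (by linarith) hxs.le) (by linarith)
        gcongr
        rwa [div_le_one hx]
    _ = _ := mul_one _

theorem norm_rpow_mul_sub_le {s : ℝ} (hs : 1 ≤ s) (a b : ℂ) :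
    ‖((‖a‖ ^ s : ℝ) : ℂ) * a - ((‖b‖ ^ s : ℝ) : ℂ) * b‖ ≤
      (1 + s) * max ‖a‖ ‖b‖ ^ s * ‖a - b‖ := by
  wlog h : ‖b‖ ≤ ‖a‖ generalizing a b
  · rw [norm_sub_rev, max_comm, norm_sub_rev a]
    exact this b a (le_of_not_ge h)
  rw [max_eq_left h]
  have h1 : ((‖a‖ ^ s : ℝ) : ℂ) * a - ((‖b‖ ^ s : ℝ) : ℂ) * b =
      ((‖a‖ ^ s : ℝ) : ℂ) * (a - b) + ((‖a‖ ^ s - ‖b‖ ^ s : ℝ) : ℂ) * b := by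
    push_cast
    ring
  have h2 : ‖b‖ ^ s ≤ ‖a‖ ^ s := by gcongr
  have h3 := rpow_sub_rpow_mul_le (norm_nonneg b) h hs
  have h4 : 0 ≤ s * ‖a‖ ^ s := by positivity
  rw [h1]
  refine (norm_add_le _ _).trans ?_
  rw [norm_mul, norm_mul, Complex.norm_real, Complex.norm_real, Real.norm_of_nonneg (by positivity),
    Real.norm_of_nonneg (sub_nonneg.mpr h2)]
  nlinarith [mul_le_mul_of_nonneg_left (norm_sub_norm_le a b) h4]

/-! ### Sobolev and Nash inequalities from isoperimetry -/

namespace MagneticGraph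

variable {V : Type*} [Fintype V] {Γ : Subgroup Circle} (G : MagneticGraph V Γ)

/-- The Dirichlet energy with respect to the measure `μ`. -/
noncomputable def energy (h : V → ℂ) : ℝ :=
  (1 / 2 : ℝ) * ∑ u, ∑ v, G.weight u v * ‖h u - G.sig u v * h v‖ ^ 2

theorem energy_nonneg (h : V → ℂ) : 0 ≤ G.energy h :=
  mul_nonneg (by norm_num) (Finset.sum_nonneg fun u _ => Finset.sum_nonneg fun v _ =>
    mul_nonneg (G.weight_nonneg u v) (sq_nonneg _))

theorem wdegree_nonneg (u : V) : 0 ≤ G.wdegree u :=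
  Finset.sum_nonneg fun v _ => G.weight_nonneg u v

theorem wdegree_le (u : V) : G.wdegree u ≤ G.maxDegree * G.μ u := by
  rw [← div_le_iff₀ (G.μ_pos u)]
  exact le_ciSup (f := fun u => G.wdegree u / G.μ u) (Set.finite_range _).bddAbove u

theorem maxDegree_nonneg : 0 ≤ G.maxDegree :=
  Real.iSup_nonneg fun u => div_nonneg (G.wdegree_nonneg u) (G.μ_pos u).le

variable {G} {δ c : ℝ}

open scoped Classical in
-- Isoperimetry of a level set, written with indicators over all ordered pairs so that it can be
-- integrated in `t`. The difference of indicators marks pairs leaving the set; `π / 4` is the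
-- rounding loss `π / 2` times the `1 / 2` for ordered pairs.
theorem HasIsoperimetricDimension.levelSet_le (hG : G.HasIsoperimetricDimension δ c)
    (hΓ : IsSignatureGroup Γ) (hδ : 1 < δ) (α r : V → ℝ) (t : ℝ) :
    c * G.vol {u | t ≤ r u} ^ ((δ - 1) / δ) ≤ ∑ u, ∑ v, G.weight u v *
      (Real.pi / 4 * ‖(Circle.exp (α u) : ℂ) - G.sig u v * Circle.exp (α v)‖ *
          (if t ≤ min (r u) (r v) then 1 else 0) +
        ((if t ≤ r u then 1 else 0) - if t ≤ min (r u) (r v) then 1 else 0)) := by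
  have hp := Real.pi_pos
  rcases Finset.eq_empty_or_nonempty ({u | t ≤ r u} : Finset V) with h | h
  · rw [h, vol, Finset.sum_empty, Real.zero_rpow (div_pos (by linarith) (by linarith)).ne',
      mul_zero]
    refine Finset.sum_nonneg fun u _ => Finset.sum_nonneg fun v _ =>
      mul_nonneg (G.weight_nonneg u v) (add_nonneg ?_ ?_)
    · split_ifs <;> positivity
    · simp only [le_min_iff]
      split_ifs <;> first | (norm_num; done) | tauto
  · refine (hG _ h).trans ((add_le_add_left (G.frustrationIndex_le_of_phase hΓ _ α) _).trans_eq ?_)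
    simp only [mul_add, Finset.sum_add_distrib, Finset.mul_sum, boundary, Finset.sum_filter,
      Finset.compl_filter, le_min_iff]
    congr 1
    · refine Finset.sum_congr rfl fun u _ => ?_
      split_ifs with hu
      · rw [Finset.mul_sum, Finset.mul_sum]
        refine Finset.sum_congr rfl fun v _ => ?_
        by_cases hv : t ≤ r v
        · simp only [hu, hv, and_self, if_true]
          ring
        · simp [hv]
      · simp [hu]
    · refine Finset.sum_congr rfl fun u _ => ?_
      split_ifs with hu
      · refine Finset.sum_congr rfl fun v _ => ?_
        by_cases hv : t ≤ r v <;> simp [hu, hv]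
      · simp [hu]

/-- Hölder on `X` with exponents `δ / (δ - 1)` and `δ`. It makes the power of the volume linear in
the indicator of `X`, so that integrating over level sets needs no Minkowski inequality. -/
theorem sum_mul_le_rpow_mul_rpow (G : MagneticGraph V Γ) (hδ : 1 < δ) (g : V → ℝ)
    (hg : ∀ u, 0 ≤ g u) (X : Finset V) :
    ∑ u ∈ X, G.μ u * g u ≤
      G.vol X ^ ((δ - 1) / δ) * (∑ u, G.μ u * g u ^ δ) ^ (1 / δ) := by
  have hδ0 : 0 < δ := by linarith
  have hδ1 : 0 < δ - 1 := by linarith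
  have hpq : (δ / (δ - 1)).HolderConjugate δ := by
    rw [Real.holderConjugate_iff]
    refine ⟨by rw [lt_div_iff₀ hδ1]; linarith, ?_⟩
    field_simp
    ring
  have hμ := fun u => (G.μ_pos u).le
  have h := Real.inner_le_Lp_mul_Lq_of_nonneg X hpq
    (f := fun u => G.μ u ^ ((δ - 1) / δ)) (g := fun u => G.μ u ^ (1 / δ) * g u)
    (fun u _ => Real.rpow_nonneg (hμ u) _)
    (fun u _ => mul_nonneg (Real.rpow_nonneg (hμ u) _) (hg u))
  have e1 : ∀ u, G.μ u ^ ((δ - 1) / δ) * (G.μ u ^ (1 / δ) * g u) = G.μ u * g u := by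
    intro u
    rw [← mul_assoc, ← Real.rpow_add (G.μ_pos u)]
    have : (δ - 1) / δ + 1 / δ = 1 := by field_simp; ring
    rw [this, Real.rpow_one]
  have e2 : ∀ u, (G.μ u ^ ((δ - 1) / δ)) ^ (δ / (δ - 1)) = G.μ u := by
    intro u
    rw [← Real.rpow_mul (hμ u)]
    have : (δ - 1) / δ * (δ / (δ - 1)) = 1 := by field_simp
    rw [this, Real.rpow_one]
  have e3 : ∀ u, (G.μ u ^ (1 / δ) * g u) ^ δ = G.μ u * g u ^ δ := by
    intro u
    rw [Real.mul_rpow (Real.rpow_nonneg (hμ u) _) (hg u), ← Real.rpow_mul (hμ u)]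
    have : 1 / δ * δ = 1 := by field_simp
    rw [this, Real.rpow_one]
  simp only [e1, e2, e3] at h
  have e4 : 1 / (δ / (δ - 1)) = (δ - 1) / δ := by field_simp
  rw [e4] at h
  have hn : ∀ u, 0 ≤ G.μ u * g u ^ δ := fun u => mul_nonneg (hμ u) (Real.rpow_nonneg (hg u) _)
  refine h.trans ?_
  unfold vol
  refine mul_le_mul_of_nonneg_left ?_ (Real.rpow_nonneg (Finset.sum_nonneg fun u _ => hμ u) _)
  refine Real.rpow_le_rpow (Finset.sum_nonneg fun u _ => hn u) ?_ (by positivity)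
  exact Finset.sum_le_sum_of_subset_of_nonneg (Finset.subset_univ X) fun u _ _ => hn u

/-- The `L¹` Sobolev inequality, in dual form. -/
theorem HasIsoperimetricDimension.sum_mul_norm_le (hG : G.HasIsoperimetricDimension δ c)
    (hc : 0 ≤ c) (hΓ : IsSignatureGroup Γ) (hδ : 1 < δ) (f : V → ℂ) (g : V → ℝ)
    (hg : ∀ u, 0 ≤ g u) :
    c * ∑ u, G.μ u * g u * ‖f u‖ ≤ (∑ u, G.μ u * g u ^ δ) ^ (1 / δ) *
      (2 * ∑ u, ∑ v, G.weight u v * ‖f u - G.sig u v * f v‖) := by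
  classical
  set K := (∑ u, G.μ u * g u ^ δ) ^ (1 / δ) with hK
  have hK0 : 0 ≤ K := Real.rpow_nonneg (Finset.sum_nonneg fun u _ =>
    mul_nonneg (G.μ_pos u).le (Real.rpow_nonneg (hg u) _)) _
  -- Any common upper bound of the `‖f u‖` serves as the end of the integration range.
  set T := ∑ u, ‖f u‖ with hT
  have hT0 : 0 ≤ T := Finset.sum_nonneg fun u _ => norm_nonneg _
  have hfT : ∀ u, ‖f u‖ ≤ T := fun u =>
    Finset.single_le_sum (f := fun u => ‖f u‖) (fun u _ => norm_nonneg _) (Finset.mem_univ u)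
  set φ : V → V → ℝ := fun u v => ‖(Circle.exp (f u).arg : ℂ) - G.sig u v * Circle.exp (f v).arg‖
  have hmin0 : ∀ u v, 0 ≤ min ‖f u‖ ‖f v‖ := fun u v => le_min (norm_nonneg _) (norm_nonneg _)
  have hminT : ∀ u v, min ‖f u‖ ‖f v‖ ≤ T := fun u v => (min_le_left _ _).trans (hfT u)
  have key : ∀ t : ℝ, c * ∑ u, G.μ u * g u * (if t ≤ ‖f u‖ then 1 else 0) ≤
      K * ∑ u, ∑ v, G.weight u v * (Real.pi / 4 * φ u v *
          (if t ≤ min ‖f u‖ ‖f v‖ then 1 else 0) +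
        ((if t ≤ ‖f u‖ then 1 else 0) - if t ≤ min ‖f u‖ ‖f v‖ then 1 else 0)) := by
    intro t
    have h1 := hG.levelSet_le hΓ hδ (fun u => (f u).arg) (fun u => ‖f u‖) t
    have h2 := G.sum_mul_le_rpow_mul_rpow hδ g hg {u | t ≤ ‖f u‖}
    refine le_trans ?_ (mul_le_mul_of_nonneg_left h1 hK0)
    simp only [mul_ite, mul_one, mul_zero]
    rw [← Finset.sum_filter]
    refine (mul_le_mul_of_nonneg_left h2 hc).trans_eq ?_
    ring
  have i1 : ∀ u, IntervalIntegrable (fun t : ℝ => if t ≤ ‖f u‖ then (1 : ℝ) else 0) volume 0 T :=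
    fun u => (integral_ite_le (norm_nonneg _) (hfT u)).1
  have i2 : ∀ u v, IntervalIntegrable
      (fun t : ℝ => if t ≤ min ‖f u‖ ‖f v‖ then (1 : ℝ) else 0) volume 0 T :=
    fun u v => (integral_ite_le (hmin0 u v) (hminT u v)).1
  have i3 : ∀ u v, IntervalIntegrable (fun t : ℝ => G.weight u v * (Real.pi / 4 * φ u v *
          (if t ≤ min ‖f u‖ ‖f v‖ then 1 else 0) +
        ((if t ≤ ‖f u‖ then 1 else 0) - if t ≤ min ‖f u‖ ‖f v‖ then 1 else 0))) volume 0 T :=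
    fun u v => (((i2 u v).const_mul _).add ((i1 u).sub (i2 u v))).const_mul _
  have i4 : ∀ u, IntervalIntegrable (fun t : ℝ => ∑ v, G.weight u v * (Real.pi / 4 * φ u v *
          (if t ≤ min ‖f u‖ ‖f v‖ then 1 else 0) +
        ((if t ≤ ‖f u‖ then 1 else 0) - if t ≤ min ‖f u‖ ‖f v‖ then 1 else 0))) volume 0 T :=
    fun u => by simpa only [Finset.sum_fn] using IntervalIntegrable.sum _ fun v _ => i3 u v
  have i5 : IntervalIntegrable (fun t : ℝ => ∑ u, ∑ v, G.weight u v * (Real.pi / 4 * φ u v *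
          (if t ≤ min ‖f u‖ ‖f v‖ then 1 else 0) +
        ((if t ≤ ‖f u‖ then 1 else 0) - if t ≤ min ‖f u‖ ‖f v‖ then 1 else 0))) volume 0 T := by
    simpa only [Finset.sum_fn] using IntervalIntegrable.sum _ fun u _ => i4 u
  have i6 : ∀ u, IntervalIntegrable
      (fun t : ℝ => G.μ u * g u * (if t ≤ ‖f u‖ then (1 : ℝ) else 0)) volume 0 T :=
    fun u => (i1 u).const_mul _
  have i7 : IntervalIntegrable
      (fun t : ℝ => ∑ u, G.μ u * g u * (if t ≤ ‖f u‖ then (1 : ℝ) else 0)) volume 0 T := by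
    simpa only [Finset.sum_fn] using IntervalIntegrable.sum _ fun u _ => i6 u
  have hmono := intervalIntegral.integral_mono_on hT0 (i7.const_mul c) (i5.const_mul K)
    fun t _ => key t
  have e1 : ∫ t in (0 : ℝ)..T, c * ∑ u, G.μ u * g u * (if t ≤ ‖f u‖ then (1 : ℝ) else 0) =
      c * ∑ u, G.μ u * g u * ‖f u‖ := by
    rw [intervalIntegral.integral_const_mul, intervalIntegral.integral_finsetSum fun u _ => i6 u]
    congr 1
    refine Finset.sum_congr rfl fun u _ => ?_
    rw [intervalIntegral.integral_const_mul, (integral_ite_le (norm_nonneg _) (hfT u)).2]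
  rw [e1, intervalIntegral.integral_const_mul,
    intervalIntegral.integral_finsetSum fun u _ => i4 u] at hmono
  refine hmono.trans (mul_le_mul_of_nonneg_left ?_ hK0)
  rw [Finset.mul_sum]
  refine Finset.sum_le_sum fun u _ => ?_
  rw [intervalIntegral.integral_finsetSum fun v _ => i3 u v, Finset.mul_sum]
  refine Finset.sum_le_sum fun v _ => ?_
  rw [intervalIntegral.integral_const_mul, mul_left_comm,
    intervalIntegral.integral_add ((i2 u v).const_mul _) ((i1 u).sub (i2 u v)),
    intervalIntegral.integral_const_mul, intervalIntegral.integral_sub (i1 u) (i2 u v),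
    (integral_ite_le (norm_nonneg _) (hfT u)).2, (integral_ite_le (hmin0 u v) (hminT u v)).2]
  refine mul_le_mul_of_nonneg_left ?_ (G.weight_nonneg u v)
  have hpolar : ∀ z : ℂ, z = (‖z‖ : ℂ) * Circle.exp z.arg := fun z => by
    rw [Circle.coe_exp, Complex.norm_mul_exp_arg_mul_I]
  have b1 : min ‖f u‖ ‖f v‖ * φ u v ≤ ‖f u - G.sig u v * f v‖ := by
    refine (min_mul_norm_sub_le (Circle.norm_coe _) (by rw [norm_mul, norm_sig, Circle.norm_coe,
      one_mul]) (norm_nonneg (f u)) (norm_nonneg (f v))).trans_eq ?_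
    rw [mul_left_comm, ← hpolar, ← hpolar]
  have b2 : ‖f u‖ - min ‖f u‖ ‖f v‖ ≤ ‖f u - G.sig u v * f v‖ := by
    have := norm_sub_norm_le (f u) (G.sig u v * f v)
    rw [norm_mul, norm_sig, one_mul] at this
    rcases min_choice ‖f u‖ ‖f v‖ with h | h <;> rw [h]
    · simp
    · exact this
  have b3 : 0 ≤ min ‖f u‖ ‖f v‖ * φ u v := mul_nonneg (hmin0 u v) (norm_nonneg _)
  -- The angular and the radial part are each at most the gradient, as `π / 4 < 1`; hence the factor
  -- `2`.
  nlinarith [Real.pi_lt_four, Real.pi_pos]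

theorem sum_weight_mul_left_le (G : MagneticGraph V Γ) {a : V → ℝ} (ha : ∀ u, 0 ≤ a u) :
    ∑ u, ∑ v, G.weight u v * a u ≤ G.maxDegree * ∑ u, G.μ u * a u := by
  rw [Finset.mul_sum]
  refine Finset.sum_le_sum fun u _ => ?_
  rw [← Finset.sum_mul, ← mul_assoc]
  exact mul_le_mul_of_nonneg_right (G.wdegree_le u) (ha u)

theorem sum_weight_mul_right_le (G : MagneticGraph V Γ) {a : V → ℝ} (ha : ∀ u, 0 ≤ a u) :
    ∑ u, ∑ v, G.weight u v * a v ≤ G.maxDegree * ∑ u, G.μ u * a u := by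
  rw [Finset.sum_comm]
  refine le_trans (le_of_eq ?_) (G.sum_weight_mul_left_le ha)
  exact Finset.sum_congr rfl fun u _ => Finset.sum_congr rfl fun v _ => by rw [G.weight_comm]

/-- The `L²` Sobolev inequality. -/
theorem HasIsoperimetricDimension.sobolev (hG : G.HasIsoperimetricDimension δ c)
    (hc : 0 ≤ c) (hΓ : IsSignatureGroup Γ) (hδ : 2 < δ) (h : V → ℂ) :
    c ^ 2 * (∑ u, G.μ u * ‖h u‖ ^ (2 * (δ / (δ - 2)))) ^ (1 - 2 / δ) ≤
      16 * (1 + δ / (δ - 2)) ^ 2 * G.maxDegree * G.energy h := by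
  have hδ2 : 0 < δ - 2 := by linarith
  set s := δ / (δ - 2) with hs
  have hs1 : 1 < s := by rw [hs, lt_div_iff₀ hδ2]; linarith
  set A := ∑ u, G.μ u * ‖h u‖ ^ (2 * s) with hA
  have hE := G.energy_nonneg h
  have hd := G.maxDegree_nonneg
  have hA0 : 0 ≤ A := Finset.sum_nonneg fun u _ => mul_nonneg (G.μ_pos u).le (by positivity)
  set S := ∑ u, ∑ v, G.weight u v *
    ‖((‖h u‖ ^ s : ℝ) : ℂ) * h u - G.sig u v * (((‖h v‖ ^ s : ℝ) : ℂ) * h v)‖ with hS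
  have hS0 : 0 ≤ S := Finset.sum_nonneg fun u _ => Finset.sum_nonneg fun v _ =>
    mul_nonneg (G.weight_nonneg u v) (norm_nonneg _)
  -- The exponent `s` is chosen so that `(s - 1) * δ = 2 * s`: then both the pairing and the
  -- `δ`-norm of the weight produce the same sum `A`.
  have h1 : c * A ≤ A ^ (1 / δ) * (2 * S) := by
    have := hG.sum_mul_norm_le hc hΓ (by linarith) (fun u => ((‖h u‖ ^ s : ℝ) : ℂ) * h u)
      (fun u => ‖h u‖ ^ (s - 1)) fun u => by positivity
    have e1 : ∀ u, G.μ u * ‖h u‖ ^ (s - 1) * ‖((‖h u‖ ^ s : ℝ) : ℂ) * h u‖ =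
        G.μ u * ‖h u‖ ^ (2 * s) := by
      intro u
      rw [norm_mul, Complex.norm_real, Real.norm_of_nonneg (by positivity), mul_assoc]
      congr 1
      rcases (norm_nonneg (h u)).eq_or_lt with h0 | h0
      · rw [← h0, mul_zero, mul_zero, Real.zero_rpow (by linarith)]
      · rw [← Real.rpow_add_one h0.ne', ← Real.rpow_add h0]
        congr 1
        ring
    have e2 : ∀ u, (‖h u‖ ^ (s - 1)) ^ δ = ‖h u‖ ^ (2 * s) := by
      intro u
      rw [← Real.rpow_mul (norm_nonneg _)]
      congr 1
      rw [hs]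
      field_simp
      ring
    simpa only [e1, e2] using this
  have h2 : S ^ 2 ≤ 4 * (1 + s) ^ 2 * G.maxDegree * G.energy h * A := by
    have hcs := Finset.sum_sq_le_sum_mul_sum_of_sq_le_mul (Finset.univ : Finset (V × V))
      (r := fun p => G.weight p.1 p.2 * ‖((‖h p.1‖ ^ s : ℝ) : ℂ) * h p.1 -
        G.sig p.1 p.2 * (((‖h p.2‖ ^ s : ℝ) : ℂ) * h p.2)‖)
      (f := fun p => G.weight p.1 p.2 * ‖h p.1 - G.sig p.1 p.2 * h p.2‖ ^ 2)
      (g := fun p => (1 + s) ^ 2 * (G.weight p.1 p.2 * ‖h p.1‖ ^ (2 * s) +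
        G.weight p.1 p.2 * ‖h p.2‖ ^ (2 * s)))
      (fun p _ => mul_nonneg (G.weight_nonneg _ _) (sq_nonneg _))
      (fun p _ => mul_nonneg (sq_nonneg _) (add_nonneg
        (mul_nonneg (G.weight_nonneg _ _) (by positivity))
        (mul_nonneg (G.weight_nonneg _ _) (by positivity)))) ?_
    · simp only [Fintype.sum_prod_type, ← Finset.mul_sum, Finset.sum_add_distrib] at hcs
      refine hcs.trans ?_
      have a1 := G.sum_weight_mul_left_le (a := fun u => ‖h u‖ ^ (2 * s)) fun u => by positivity
      have a2 := G.sum_weight_mul_right_le (a := fun u => ‖h u‖ ^ (2 * s)) fun u => by positivity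
      have a3 : ∑ u, ∑ v, G.weight u v * ‖h u - G.sig u v * h v‖ ^ 2 = 2 * G.energy h := by
        rw [energy]; ring
      rw [a3]
      calc 2 * G.energy h * ((1 + s) ^ 2 * ((∑ u, ∑ v, G.weight u v * ‖h u‖ ^ (2 * s)) +
            ∑ u, ∑ v, G.weight u v * ‖h v‖ ^ (2 * s)))
          ≤ 2 * G.energy h * ((1 + s) ^ 2 * (G.maxDegree * A + G.maxDegree * A)) := by gcongr
        _ = _ := by ring
    · rintro ⟨u, v⟩ -
      dsimp only
      have b1 := norm_rpow_mul_sub_le hs1.le (h u) (G.sig u v * h v)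
      rw [norm_mul, norm_sig, one_mul, mul_left_comm] at b1
      set m := max ‖h u‖ ‖h v‖ with hm
      have b2 : (m ^ s) ^ 2 ≤ ‖h u‖ ^ (2 * s) + ‖h v‖ ^ (2 * s) := by
        have : (m ^ s) ^ 2 = m ^ (2 * s) := by
          rw [← Real.rpow_natCast, ← Real.rpow_mul (by positivity)]
          congr 1
          push_cast
          ring
        rw [this]
        have p1 : 0 ≤ ‖h u‖ ^ (2 * s) := by positivity
        have p2 : 0 ≤ ‖h v‖ ^ (2 * s) := by positivity
        rcases max_choice ‖h u‖ ‖h v‖ with h | h <;> rw [hm, h] <;> linarith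
      have hw := G.weight_nonneg u v
      calc _ = G.weight u v ^ 2 * ‖((‖h u‖ ^ s : ℝ) : ℂ) * h u -
            G.sig u v * (((‖h v‖ ^ s : ℝ) : ℂ) * h v)‖ ^ 2 := by ring
        _ ≤ G.weight u v ^ 2 * ((1 + s) * m ^ s * ‖h u - G.sig u v * h v‖) ^ 2 := by gcongr
        _ = G.weight u v ^ 2 * ‖h u - G.sig u v * h v‖ ^ 2 * (1 + s) ^ 2 * (m ^ s) ^ 2 := by ring
        _ ≤ G.weight u v ^ 2 * ‖h u - G.sig u v * h v‖ ^ 2 * (1 + s) ^ 2 *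
            (‖h u‖ ^ (2 * s) + ‖h v‖ ^ (2 * s)) := by gcongr
        _ = _ := by ring
  rcases hA0.eq_or_lt with h0 | h0
  · rw [← h0, Real.zero_rpow, mul_zero]
    · positivity
    · have : 2 / δ < 1 := by rw [div_lt_one (by linarith)]; exact hδ
      linarith
  have h3 : (c * A) ^ 2 ≤ (A ^ (1 / δ) * (2 * S)) ^ 2 := by gcongr
  have h4 : A ^ 2 = A ^ (1 - 2 / δ) * (A * (A ^ (1 / δ)) ^ 2) := by
    rw [← Real.rpow_natCast (A ^ (1 / δ)), ← Real.rpow_mul h0.le]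
    nth_rewrite 3 [← Real.rpow_one A]
    rw [← Real.rpow_add h0, ← Real.rpow_add h0, ← Real.rpow_natCast]
    congr 1
    push_cast
    ring
  have hp : 0 < A * (A ^ (1 / δ)) ^ 2 := by positivity
  refine le_of_mul_le_mul_right ?_ hp
  calc c ^ 2 * A ^ (1 - 2 / δ) * (A * (A ^ (1 / δ)) ^ 2) = (c * A) ^ 2 := by
        rw [mul_pow, h4]; ring
    _ ≤ (A ^ (1 / δ) * (2 * S)) ^ 2 := h3
    _ = 4 * (A ^ (1 / δ)) ^ 2 * S ^ 2 := by ring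
    _ ≤ 4 * (A ^ (1 / δ)) ^ 2 * (4 * (1 + s) ^ 2 * G.maxDegree * G.energy h * A) := by gcongr
    _ = _ := by ring

/-- The Nash inequality. -/
theorem HasIsoperimetricDimension.nash (hG : G.HasIsoperimetricDimension δ c)
    (hc : 0 ≤ c) (hΓ : IsSignatureGroup Γ) (hδ : 2 < δ) (h : V → ℂ)
    (hF : ∑ u, G.μ u * ‖h u‖ ≤ 1) :
    c ^ 2 * (∑ u, G.μ u * ‖h u‖ ^ 2) ^ (1 + 2 / δ) ≤
      16 * (1 + δ / (δ - 2)) ^ 2 * G.maxDegree * G.energy h := by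
  refine le_trans (mul_le_mul_of_nonneg_left ?_ (sq_nonneg c)) (hG.sobolev hc hΓ hδ h)
  have hδ2 : 0 < δ - 2 := by linarith
  have hδ0 : 0 < δ := by linarith
  have hδ3 : 0 < δ + 2 := by linarith
  have hμ := fun u => (G.μ_pos u).le
  -- These exponents interpolate L² between L¹ and the Sobolev space of exponent `2δ / (δ - 2)`.
  have hpq : ((δ + 2) / 4).HolderConjugate ((δ + 2) / (δ - 2)) := by
    rw [Real.holderConjugate_iff]
    refine ⟨by rw [lt_div_iff₀ (by norm_num)]; linarith, ?_⟩
    field_simp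
    ring
  have hold := Real.inner_le_Lp_mul_Lq_of_nonneg Finset.univ hpq
    (f := fun u => (G.μ u * ‖h u‖) ^ (4 / (δ + 2)))
    (g := fun u => (G.μ u * ‖h u‖ ^ (2 * (δ / (δ - 2)))) ^ ((δ - 2) / (δ + 2)))
    (fun u _ => Real.rpow_nonneg (mul_nonneg (hμ u) (by positivity)) _)
    (fun u _ => Real.rpow_nonneg (mul_nonneg (hμ u) (by positivity)) _)
  have e1 : ∀ u, (G.μ u * ‖h u‖) ^ (4 / (δ + 2)) *
      (G.μ u * ‖h u‖ ^ (2 * (δ / (δ - 2)))) ^ ((δ - 2) / (δ + 2)) = G.μ u * ‖h u‖ ^ 2 := by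
    intro u
    rcases (norm_nonneg (h u)).eq_or_lt with h0 | h0
    · rw [← h0, mul_zero, Real.zero_rpow (by positivity)]
      simp
    · rw [Real.mul_rpow (hμ u) h0.le, Real.mul_rpow (hμ u) (by positivity),
        ← Real.rpow_mul h0.le, mul_mul_mul_comm, ← Real.rpow_add (G.μ_pos u), ← Real.rpow_add h0]
      have q1 : 4 / (δ + 2) + (δ - 2) / (δ + 2) = 1 := by field_simp; ring
      have q2 : 4 / (δ + 2) + 2 * (δ / (δ - 2)) * ((δ - 2) / (δ + 2)) = (2 : ℕ) := by
        push_cast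
        field_simp
        ring
      rw [q1, q2, Real.rpow_one, Real.rpow_natCast]
  have e2 : ∀ u, ((G.μ u * ‖h u‖) ^ (4 / (δ + 2))) ^ ((δ + 2) / 4) = G.μ u * ‖h u‖ := by
    intro u
    rw [← Real.rpow_mul (mul_nonneg (hμ u) (norm_nonneg _))]
    have : 4 / (δ + 2) * ((δ + 2) / 4) = 1 := by field_simp
    rw [this, Real.rpow_one]
  have e3 : ∀ u, ((G.μ u * ‖h u‖ ^ (2 * (δ / (δ - 2)))) ^ ((δ - 2) / (δ + 2))) ^
      ((δ + 2) / (δ - 2)) = G.μ u * ‖h u‖ ^ (2 * (δ / (δ - 2))) := by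
    intro u
    rw [← Real.rpow_mul (mul_nonneg (hμ u) (by positivity))]
    have : (δ - 2) / (δ + 2) * ((δ + 2) / (δ - 2)) = 1 := by field_simp
    rw [this, Real.rpow_one]
  simp only [e1, e2, e3] at hold
  set A := ∑ u, G.μ u * ‖h u‖ ^ (2 * (δ / (δ - 2)))
  set B := ∑ u, G.μ u * ‖h u‖ ^ 2
  have hA0 : 0 ≤ A := Finset.sum_nonneg fun u _ => mul_nonneg (hμ u) (by positivity)
  have hB0 : 0 ≤ B := Finset.sum_nonneg fun u _ => mul_nonneg (hμ u) (by positivity)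
  have hF0 : 0 ≤ ∑ u, G.μ u * ‖h u‖ := Finset.sum_nonneg fun u _ =>
    mul_nonneg (hμ u) (norm_nonneg _)
  have hBA : B ≤ A ^ (1 / ((δ + 2) / (δ - 2))) :=
    hold.trans (mul_le_of_le_one_left (by positivity)
      (Real.rpow_le_one hF0 hF (by positivity)))
  calc B ^ (1 + 2 / δ) ≤ (A ^ (1 / ((δ + 2) / (δ - 2)))) ^ (1 + 2 / δ) := by gcongr
    _ = A ^ (1 - 2 / δ) := by
        rw [← Real.rpow_mul hA0]
        congr 1
        field_simp

end MagneticGraph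

/-! ### Traces of powers and decay of a recursive sequence -/

theorem Matrix.IsHermitian.trace_one_sub_smul_pow {n : Type*} [Fintype n] [DecidableEq n]
    {A : Matrix n n ℂ} (hA : A.IsHermitian) (a : ℝ) (k : ℕ) :
    ((1 - (a : ℂ) • A) ^ k).trace = ((∑ i, (1 - a * hA.eigenvalues i) ^ k : ℝ) : ℂ) := by
  have h1 : 1 - (a : ℂ) • A = Unitary.conjStarAlgAut ℂ _ hA.eigenvectorUnitary
      (Matrix.diagonal fun i => ((1 - a * hA.eigenvalues i : ℝ) : ℂ)) := by
    have : (Matrix.diagonal fun i => ((1 - a * hA.eigenvalues i : ℝ) : ℂ)) =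
        1 - (a : ℂ) • Matrix.diagonal (RCLike.ofReal ∘ hA.eigenvalues) := by
      rw [← Matrix.diagonal_one, ← Matrix.diagonal_smul, Matrix.diagonal_sub]
      congr 1
      funext i
      simp
    rw [this, map_sub, map_one, map_smul, ← hA.spectral_theorem]
  rw [h1, ← map_pow, Unitary.conjStarAlgAut_apply, Matrix.trace_mul_cycle,
    Unitary.coe_star_mul_self, one_mul, Matrix.diagonal_pow, Matrix.trace_diagonal]
  simp

theorem Matrix.IsHermitian.sum_norm_sq_pow {n : Type*} [Fintype n] [DecidableEq n]
    {B : Matrix n n ℂ} (hB : B.IsHermitian) (k : ℕ) :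
    ((∑ j, ∑ i, ‖(B ^ k) i j‖ ^ 2 : ℝ) : ℂ) = (B ^ (2 * k)).trace := by
  have h : B ^ (2 * k) = (B ^ k).conjTranspose * B ^ k := by
    rw [(hB.pow k).eq, ← pow_add, two_mul]
  rw [h, Matrix.trace]
  push_cast
  refine Finset.sum_congr rfl fun j _ => ?_
  rw [Matrix.diag_apply, Matrix.mul_apply]
  refine Finset.sum_congr rfl fun i _ => ?_
  rw [Matrix.conjTranspose_apply, RCLike.star_def, Complex.conj_mul']

theorem mul_exp_neg_mul_le {K n y : ℝ} (hK : 0 ≤ K) (hy : 0 ≤ y) (h : K * n * y ≤ 1) :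
    K * (n + 1) * (y * Real.exp (-(K * y))) ≤ 1 := by
  have hKy : 0 ≤ K * y := mul_nonneg hK hy
  have h1 : 1 + K * y ≤ Real.exp (K * y) := by linarith [Real.add_one_le_exp (K * y)]
  rw [Real.exp_neg, ← mul_assoc, ← div_eq_mul_inv, div_le_one (Real.exp_pos _)]
  linarith

/-- A nonnegative sequence with `a (n+1) ≤ a n - C (a n)^(1+θ)` decays like `n^(-1/θ)`. -/
theorem mul_rpow_le_one_of_step {a : ℕ → ℝ} (ha : ∀ n, 0 ≤ a n) {C θ : ℝ} (hC : 0 ≤ C)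
    (hθ : 0 < θ) (hstep : ∀ n, a (n + 1) ≤ a n - C * a n ^ (1 + θ)) (n : ℕ) :
    θ * C * n * a n ^ θ ≤ 1 := by
  have hK : 0 ≤ θ * C := mul_nonneg hθ.le hC
  induction n with
  | zero => simp
  | succ n ih =>
    have hy : 0 ≤ a n ^ θ := Real.rpow_nonneg (ha n) _
    have h1 : a (n + 1) ≤ a n * Real.exp (-(C * a n ^ θ)) := by
      refine (hstep n).trans ?_
      rw [Real.rpow_add' (ha n) (by linarith), Real.rpow_one]
      nlinarith [Real.add_one_le_exp (-(C * a n ^ θ)), ha n]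
    have h2 : a (n + 1) ^ θ ≤ a n ^ θ * Real.exp (-(θ * C * a n ^ θ)) := by
      refine (Real.rpow_le_rpow (ha _) h1 hθ.le).trans_eq ?_
      rw [Real.mul_rpow (ha n) (Real.exp_pos _).le, ← Real.exp_mul]
      congr 2
      ring
    push_cast
    refine le_trans (mul_le_mul_of_nonneg_left h2 (by positivity)) ?_
    exact mul_exp_neg_mul_le hK hy ih

theorem norm_sum_mul_sq_le {ι : Type*} [Fintype ι] {w : ι → ℝ} (hw : ∀ i, 0 ≤ w i) (x : ι → ℂ) :
    ‖∑ i, (w i : ℂ) * x i‖ ^ 2 ≤ (∑ i, w i) * ∑ i, w i * ‖x i‖ ^ 2 := by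
  have h1 : ‖∑ i, (w i : ℂ) * x i‖ ≤ ∑ i, w i * ‖x i‖ := by
    refine (norm_sum_le _ _).trans_eq (Finset.sum_congr rfl fun i _ => ?_)
    rw [norm_mul, Complex.norm_real, Real.norm_of_nonneg (hw i)]
  refine (pow_le_pow_left₀ (norm_nonneg _) h1 2).trans ?_
  refine Finset.sum_sq_le_sum_mul_sum_of_sq_le_mul _ (fun i _ => hw i)
    (fun i _ => mul_nonneg (hw i) (sq_nonneg _)) fun i _ => ?_
  exact le_of_eq (by ring)

/-! ### The lazy magnetic walk and its heat kernel -/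

namespace MagneticGraph

variable {V : Type*} [Fintype V] {Γ : Subgroup Circle} (G : MagneticGraph V Γ)

/-- The net flow `∑ w_uv (f(u) - σ_uv f(v))` out of `u`. -/
noncomputable def flow (f : V → ℂ) (u : V) : ℂ :=
  ∑ v, (G.weight u v : ℂ) * (f u - G.sig u v * f v)

/-- One step `f - Δf / (2d)` of the lazy magnetic random walk, with respect to the measure `μ`. -/
noncomputable def lazyStep (f : V → ℂ) (u : V) : ℂ :=
  f u - G.flow f u / ((2 * G.maxDegree * G.μ u : ℝ) : ℂ)

/-- Green's formula. -/
theorem sum_re_conj_mul_flow (f : V → ℂ) :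
    ∑ u, ((starRingEnd ℂ) (f u) * G.flow f u).re = G.energy f := by
  set a : V → V → ℝ := fun u v =>
    G.weight u v * ((starRingEnd ℂ) (f u) * (f u - G.sig u v * f v)).re with ha
  have h1 : ∑ u, ((starRingEnd ℂ) (f u) * G.flow f u).re = ∑ u, ∑ v, a u v := by
    refine Finset.sum_congr rfl fun u _ => ?_
    rw [flow, Finset.mul_sum, Complex.re_sum]
    refine Finset.sum_congr rfl fun v _ => ?_
    rw [mul_left_comm, Complex.re_ofReal_mul]
  have h2 : ∑ u, ∑ v, a u v = (1 / 2 : ℝ) * ∑ u, ∑ v, (a u v + a v u) := by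
    simp only [Finset.sum_add_distrib]
    rw [Finset.sum_comm (f := fun u v => a v u)]
    ring
  rw [h1, h2, energy]
  congr 1
  refine Finset.sum_congr rfl fun u _ => Finset.sum_congr rfl fun v _ => ?_
  by_cases h : G.graph.Adj u v
  · rw [ha]
    dsimp only
    rw [G.weight_comm v u, ← mul_add, G.sig_swap h]
    congr 1
    have hs : (G.sig u v).re ^ 2 + (G.sig u v).im ^ 2 = 1 := by
      have := Complex.sq_norm (G.sig u v)
      rw [G.norm_sig, Complex.normSq_apply] at this
      linarith
    rw [Complex.sq_norm, Complex.normSq_apply]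
    simp only [Complex.mul_re, Complex.mul_im, Complex.sub_re, Complex.sub_im, Complex.conj_re,
      Complex.conj_im]
    linear_combination (-(f v).re ^ 2 - (f v).im ^ 2) * hs
  · have h' : ¬ G.graph.Adj v u := fun h' => h h'.symm
    simp [ha, weight, h, h']

/-- Laziness keeps the diagonal coefficient nonnegative and the signature has modulus one, so in
absolute value the step is dominated by a mass-preserving walk. -/
theorem sum_norm_lazyStep_le (hd : 0 < G.maxDegree) (f : V → ℂ) :
    ∑ u, G.μ u * ‖G.lazyStep f u‖ ≤ ∑ u, G.μ u * ‖f u‖ := by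
  set d := G.maxDegree with hdd
  have h1 : ∀ u, G.μ u * ‖G.lazyStep f u‖ ≤
      (G.μ u - G.wdegree u / (2 * d)) * ‖f u‖ + ∑ v, G.weight u v * ‖f v‖ / (2 * d) := by
    intro u
    have hμ := G.μ_pos u
    have hw := G.wdegree_le u
    have hw0 := G.wdegree_nonneg u
    have e : (G.μ u : ℂ) * G.lazyStep f u = ((G.μ u - G.wdegree u / (2 * d) : ℝ) : ℂ) * f u +
        ∑ v, ((G.weight u v / (2 * d) : ℝ) : ℂ) * (G.sig u v * f v) := by
      have hμ' : (G.μ u : ℂ) ≠ 0 := by exact_mod_cast hμ.ne'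
      have hd' : (d : ℂ) ≠ 0 := by exact_mod_cast hd.ne'
      have e1 : G.flow f u = G.wdegree u * f u - ∑ v, (G.weight u v : ℂ) * (G.sig u v * f v) := by
        rw [flow, wdegree]
        simp only [mul_sub, Finset.sum_sub_distrib]
        push_cast
        rw [Finset.sum_mul]
      have e2 : ∑ v, ((G.weight u v / (2 * d) : ℝ) : ℂ) * (G.sig u v * f v) =
          (∑ v, (G.weight u v : ℂ) * (G.sig u v * f v)) / (2 * d) := by
        rw [Finset.sum_div]
        refine Finset.sum_congr rfl fun v _ => ?_
        push_cast
        ring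
      rw [e2, lazyStep, e1, ← hdd]
      push_cast
      field_simp
      ring
    have e' : G.μ u * ‖G.lazyStep f u‖ = ‖(G.μ u : ℂ) * G.lazyStep f u‖ := by
      rw [norm_mul, Complex.norm_real, Real.norm_of_nonneg hμ.le]
    have hnn : 0 ≤ G.μ u - G.wdegree u / (2 * d) := by
      rw [sub_nonneg, div_le_iff₀ (by linarith)]
      nlinarith
    rw [e', e]
    refine (norm_add_le _ _).trans (add_le_add ?_ ((norm_sum_le _ _).trans
      (Finset.sum_le_sum fun v _ => ?_)))
    · rw [norm_mul, Complex.norm_real, Real.norm_of_nonneg hnn]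
    · have := G.weight_nonneg u v
      rw [norm_mul, norm_mul, norm_sig, one_mul, Complex.norm_real,
        Real.norm_of_nonneg (by positivity)]
      exact le_of_eq (by ring)
  refine (Finset.sum_le_sum fun u _ => h1 u).trans_eq ?_
  have h2 : ∑ u, ∑ v, G.weight u v * ‖f v‖ / (2 * d) = ∑ u, G.wdegree u / (2 * d) * ‖f u‖ := by
    rw [Finset.sum_comm]
    refine Finset.sum_congr rfl fun v _ => ?_
    rw [wdegree, Finset.sum_div, Finset.sum_mul]
    refine Finset.sum_congr rfl fun u _ => ?_
    rw [G.weight_comm]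
    ring
  rw [Finset.sum_add_distrib, h2, ← Finset.sum_add_distrib]
  exact Finset.sum_congr rfl fun u _ => by ring

/-- Expanding the square, Green's formula contributes `-energy / d`, while Cauchy–Schwarz bounds the
quadratic term by `energy / (2d)`. -/
theorem sum_sq_lazyStep_le (hd : 0 < G.maxDegree) (f : V → ℂ) :
    ∑ u, G.μ u * ‖G.lazyStep f u‖ ^ 2 ≤
      ∑ u, G.μ u * ‖f u‖ ^ 2 - G.energy f / (2 * G.maxDegree) := by
  set d := G.maxDegree with hdd
  have h1 : ∀ u, G.μ u * ‖G.lazyStep f u‖ ^ 2 ≤ G.μ u * ‖f u‖ ^ 2 -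
      1 / d * ((starRingEnd ℂ) (f u) * G.flow f u).re +
      1 / (4 * d) * ∑ v, G.weight u v * ‖f u - G.sig u v * f v‖ ^ 2 := by
    intro u
    have hμ := G.μ_pos u
    have e : G.μ u * ‖G.lazyStep f u‖ ^ 2 = G.μ u * ‖f u‖ ^ 2 -
        1 / d * ((starRingEnd ℂ) (f u) * G.flow f u).re +
        1 / (4 * d ^ 2 * G.μ u) * ‖G.flow f u‖ ^ 2 := by
      rw [lazyStep, ← hdd, Complex.sq_norm, Complex.sq_norm, Complex.sq_norm]
      simp only [Complex.normSq_apply, Complex.sub_re, Complex.sub_im, Complex.div_ofReal_re,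
        Complex.div_ofReal_im, Complex.mul_re, Complex.conj_re, Complex.conj_im]
      field_simp
      ring
    rw [e]
    refine add_le_add le_rfl ?_
    have hcs := norm_sum_mul_sq_le (G.weight_nonneg u) fun v => f u - G.sig u v * f v
    have hS : 0 ≤ ∑ v, G.weight u v * ‖f u - G.sig u v * f v‖ ^ 2 :=
      Finset.sum_nonneg fun v _ => mul_nonneg (G.weight_nonneg u v) (sq_nonneg _)
    have h3 : ‖G.flow f u‖ ^ 2 ≤
        d * G.μ u * ∑ v, G.weight u v * ‖f u - G.sig u v * f v‖ ^ 2 :=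
      hcs.trans (mul_le_mul_of_nonneg_right (G.wdegree_le u) hS)
    refine (mul_le_mul_of_nonneg_left h3 (by positivity)).trans_eq ?_
    field_simp
  refine (Finset.sum_le_sum fun u _ => h1 u).trans_eq ?_
  rw [Finset.sum_add_distrib, Finset.sum_sub_distrib, ← Finset.mul_sum, ← Finset.mul_sum,
    sum_re_conj_mul_flow]
  have : ∑ u, ∑ v, G.weight u v * ‖f u - G.sig u v * f v‖ ^ 2 = 2 * G.energy f := by
    rw [energy]
    ring
  rw [this]
  field_simp
  ring

theorem HasIsoperimetricDimension.mul_rpow_iterate_le_one {G : MagneticGraph V Γ} {δ c : ℝ}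
    (hG : G.HasIsoperimetricDimension δ c) (hc : 0 ≤ c) (hΓ : IsSignatureGroup Γ) (hδ : 2 < δ)
    (hd : 0 < G.maxDegree) (f : V → ℂ) (hf : ∑ u, G.μ u * ‖f u‖ ≤ 1) (n : ℕ) :
    2 / δ * (c ^ 2 / (32 * (1 + δ / (δ - 2)) ^ 2 * G.maxDegree ^ 2)) * n *
      (∑ u, G.μ u * ‖G.lazyStep^[n] f u‖ ^ 2) ^ (2 / δ) ≤ 1 := by
  have hδ0 : 0 < δ := by linarith
  have hδ2 : 0 < δ - 2 := by linarith
  have hs : 0 < 1 + δ / (δ - 2) := by positivity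
  have hF : ∀ n, ∑ u, G.μ u * ‖G.lazyStep^[n] f u‖ ≤ 1 := by
    intro n
    induction n with
    | zero => simpa using hf
    | succ n ih =>
      rw [Function.iterate_succ_apply']
      exact (G.sum_norm_lazyStep_le hd _).trans ih
  refine mul_rpow_le_one_of_step (a := fun n => ∑ u, G.μ u * ‖G.lazyStep^[n] f u‖ ^ 2)
    (fun n => Finset.sum_nonneg fun u _ => mul_nonneg (G.μ_pos u).le (sq_nonneg _))
    (by positivity) (by positivity) (fun n => ?_) n
  simp only [Function.iterate_succ_apply']
  refine (G.sum_sq_lazyStep_le hd _).trans (sub_le_sub_left ?_ _)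
  have h := hG.nash hc hΓ hδ _ (hF n)
  rw [div_mul_eq_mul_div, div_le_div_iff₀ (by positivity) (by positivity)]
  refine (mul_le_mul_of_nonneg_right h (by positivity)).trans_eq ?_
  ring

open scoped Classical in
-- Conjugation by `√μ` turns the Hermitian matrix into the walk.
theorem one_sub_smul_laplacianMatrix_mulVec (g : V → ℂ) (u : V) :
    ((1 - ((1 / (2 * G.maxDegree) : ℝ) : ℂ) • G.laplacianMatrix).mulVec
      fun v => (√(G.μ v) : ℂ) * g v) u = (√(G.μ u) : ℂ) * G.lazyStep g u := by
  have hμ : ∀ u, (√(G.μ u) : ℂ) ≠ 0 := fun u => by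
    exact_mod_cast (Real.sqrt_pos.mpr (G.μ_pos u)).ne'
  have hsq : (√(G.μ u) : ℂ) * √(G.μ u) = G.μ u := by
    rw [← Complex.ofReal_mul, Real.mul_self_sqrt (G.μ_pos u).le]
  have hL : (G.laplacianMatrix.mulVec fun v => (√(G.μ v) : ℂ) * g v) u =
      1 / (√(G.μ u) : ℂ) * G.flow g u := by
    rw [laplacianMatrix, LinearMap.toMatrix'_mulVec]
    simp only [laplacian, LinearMap.coe_mk, AddHom.coe_mk, flow]
    congr 1
    refine Finset.sum_congr rfl fun v _ => ?_
    rw [mul_div_cancel_left₀ _ (hμ u), mul_div_cancel_left₀ _ (hμ v)]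
  rw [Matrix.sub_mulVec, Matrix.one_mulVec, Matrix.smul_mulVec, Pi.sub_apply, Pi.smul_apply, hL,
    lazyStep, smul_eq_mul, mul_sub]
  congr 1
  push_cast
  rw [← hsq]
  by_cases hd : (G.maxDegree : ℂ) = 0
  · simp [hd]
  have := hμ u
  field_simp

open scoped Classical in
theorem one_sub_smul_laplacianMatrix_pow_mulVec (g : V → ℂ) (n : ℕ) :
    ((1 - ((1 / (2 * G.maxDegree) : ℝ) : ℂ) • G.laplacianMatrix) ^ n).mulVec
      (fun v => (√(G.μ v) : ℂ) * g v) = fun u => (√(G.μ u) : ℂ) * G.lazyStep^[n] g u := by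
  induction n with
  | zero => simp
  | succ n ih =>
    rw [pow_succ', ← Matrix.mulVec_mulVec, ih]
    funext u
    rw [one_sub_smul_laplacianMatrix_mulVec, Function.iterate_succ_apply']

open scoped Classical in
/-- The column of the `n`-step kernel at `w`, as the walk started from the normalized point mass. -/
theorem sum_sq_iterate_single (w : V) (n : ℕ) :
    ∑ u, G.μ u * ‖G.lazyStep^[n] (Pi.single w (1 / (G.μ w : ℂ))) u‖ ^ 2 =
      (∑ u, ‖((1 - ((1 / (2 * G.maxDegree) : ℝ) : ℂ) • G.laplacianMatrix) ^ n) u w‖ ^ 2) /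
        G.μ w := by
  have hμ := fun u => G.μ_pos u
  have h := G.one_sub_smul_laplacianMatrix_pow_mulVec (Pi.single w (1 / (G.μ w : ℂ))) n
  have e : (fun v => (√(G.μ v) : ℂ) * (Pi.single w (1 / (G.μ w : ℂ)) : V → ℂ) v) =
      Pi.single w ((√(G.μ w) : ℂ) * (1 / (G.μ w : ℂ))) := by
    funext v
    by_cases hv : v = w
    · subst hv; simp
    · simp [hv]
  rw [e, Matrix.mulVec_single] at h
  rw [Finset.sum_div]
  refine Finset.sum_congr rfl fun u _ => ?_
  have hu := congrArg (fun z => ‖z‖ ^ 2) (congrFun h u)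
  simp only [Pi.smul_apply, MulOpposite.smul_eq_mul_unop, MulOpposite.unop_op, Matrix.col_apply,
    norm_mul, mul_pow, norm_div, norm_one, Complex.norm_real,
    Real.norm_of_nonneg (Real.sqrt_nonneg _), Real.sq_sqrt (hμ _).le,
    Real.norm_of_nonneg (hμ _).le] at hu
  rw [← hu]
  have := (hμ w).ne'
  field_simp

open scoped Classical in
theorem sum_eigenvalues_eq (F : ℝ → ℝ) :
    ∑ i, F (G.laplacianMatrix_isHermitian.eigenvalues i) = ∑ k, F (G.eigenvalue k) := by
  rw [← Equiv.sum_comp (Fintype.equivOfCardEq (Fintype.card_fin (Fintype.card V))),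
    ← Equiv.sum_comp Fin.revPerm]
  simp [eigenvalue, Matrix.IsHermitian.eigenvalues]

/-- The left side is the trace of `M ^ (2n)`, that is, the squared Hilbert–Schmidt norm of `M ^ n`;
each column is a walk started from a point mass and obeys the Nash decay. -/
theorem HasIsoperimetricDimension.sum_eigenvalue_pow_le {G : MagneticGraph V Γ} {δ c : ℝ}
    (hG : G.HasIsoperimetricDimension δ c) (hc : 0 < c) (hΓ : IsSignatureGroup Γ) (hδ : 2 < δ)
    (hd : 0 < G.maxDegree) {n : ℕ} (hn : 0 < n) :
    ∑ k, (1 - G.eigenvalue k / (2 * G.maxDegree)) ^ (2 * n) ≤ G.vol Finset.univ *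
      (1 / (2 / δ * (c ^ 2 / (32 * (1 + δ / (δ - 2)) ^ 2 * G.maxDegree ^ 2)) * n)) ^ (δ / 2) := by
  classical
  have hδ0 : 0 < δ := by linarith
  have hδ2 : 0 < δ - 2 := by linarith
  have hs : 0 < 1 + δ / (δ - 2) := by positivity
  have hn' : (0 : ℝ) < n := by exact_mod_cast hn
  set K := 2 / δ * (c ^ 2 / (32 * (1 + δ / (δ - 2)) ^ 2 * G.maxDegree ^ 2)) with hK
  have hK0 : 0 < K := by positivity
  have hL := G.laplacianMatrix_isHermitian
  set M := 1 - ((1 / (2 * G.maxDegree) : ℝ) : ℂ) • G.laplacianMatrix with hM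
  have hMH : M.IsHermitian := by
    refine Matrix.isHermitian_one.sub ?_
    rw [Matrix.IsHermitian, Matrix.conjTranspose_smul, hL.eq, RCLike.star_def, Complex.conj_ofReal]
  have hcol : ∀ w, ∑ u, ‖(M ^ n) u w‖ ^ 2 ≤ G.μ w * (1 / (K * n)) ^ (δ / 2) := by
    intro w
    have hμ := G.μ_pos w
    have h1 : ∑ u, G.μ u * ‖(Pi.single w (1 / (G.μ w : ℂ)) : V → ℂ) u‖ ≤ 1 := by
      rw [Finset.sum_eq_single w]
      · simp [abs_of_pos hμ, hμ.ne']
      · intro u _ hu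
        simp [hu]
      · simp
    have h2 := hG.mul_rpow_iterate_le_one hc.le hΓ hδ hd _ h1 n
    rw [G.sum_sq_iterate_single] at h2
    set a := (∑ u, ‖(M ^ n) u w‖ ^ 2) / G.μ w with ha
    have ha0 : 0 ≤ a := div_nonneg (Finset.sum_nonneg fun u _ => sq_nonneg _) hμ.le
    have h3 : a ^ (2 / δ) ≤ 1 / (K * n) := by
      rw [le_div_iff₀ (by positivity), mul_comm]
      exact h2
    have h4 : a ≤ (1 / (K * n)) ^ (δ / 2) := by
      calc a = (a ^ (2 / δ)) ^ (δ / 2) := by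
            rw [← Real.rpow_mul ha0]
            have : 2 / δ * (δ / 2) = 1 := by field_simp
            rw [this, Real.rpow_one]
        _ ≤ _ := by gcongr
    rw [ha, div_le_iff₀ hμ] at h4
    linarith
  have htr : ∑ k, (1 - G.eigenvalue k / (2 * G.maxDegree)) ^ (2 * n) =
      ∑ w, ∑ u, ‖(M ^ n) u w‖ ^ 2 := by
    have e1 := hMH.sum_norm_sq_pow n
    rw [hM, hL.trace_one_sub_smul_pow, Complex.ofReal_inj] at e1
    rw [hM, e1, G.sum_eigenvalues_eq fun x => (1 - 1 / (2 * G.maxDegree) * x) ^ (2 * n)]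
    refine Finset.sum_congr rfl fun k _ => ?_
    congr 2
    ring
  rw [htr, vol, Finset.sum_mul]
  exact Finset.sum_le_sum fun w _ => hcol w

end MagneticGraph

/-! ### From the trace bound to the eigenvalues -/

namespace MagneticGraph

variable {V : Type*} [Fintype V] {Γ : Subgroup Circle} {G : MagneticGraph V Γ} {δ c : ℝ}

open scoped Classical in
-- A single vertex has no frustration and its boundary is at most its degree.
theorem HasIsoperimetricDimension.le_maxDegree_mul (hG : G.HasIsoperimetricDimension δ c)
    (hδ : 0 < δ) (u : V) : c ≤ G.maxDegree * G.μ u ^ (1 / δ) := by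
  have hμ := G.μ_pos u
  have h := hG {u} (Finset.singleton_nonempty u)
  have h1 : G.frustrationIndex {u} ≤ 0 := by
    refine (G.frustrationIndex_le {u} fun _ => 1).trans_eq ?_
    rw [Finset.sum_eq_zero, mul_zero]
    rintro ⟨x, hx⟩ -
    refine Finset.sum_eq_zero ?_
    rintro ⟨y, hy⟩ -
    rw [Finset.mem_singleton] at hx hy
    subst hx hy
    rw [weight_self, zero_mul]
  have h2 : G.boundary {u} ≤ G.wdegree u := by
    rw [boundary, Finset.sum_singleton]
    exact Finset.sum_le_sum_of_subset_of_nonneg (Finset.subset_univ _)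
      fun v _ _ => G.weight_nonneg u v
  have h3 : G.vol {u} = G.μ u := Finset.sum_singleton _ _
  have h4 : G.μ u = G.μ u ^ (1 / δ) * G.μ u ^ ((δ - 1) / δ) := by
    rw [← Real.rpow_add hμ]
    have : 1 / δ + (δ - 1) / δ = 1 := by field_simp; ring
    rw [this, Real.rpow_one]
  have h5 : c * G.μ u ^ ((δ - 1) / δ) ≤
      G.maxDegree * G.μ u ^ (1 / δ) * G.μ u ^ ((δ - 1) / δ) := by
    rw [mul_assoc, ← h4]
    rw [h3] at h
    linarith [G.wdegree_le u]
  exact le_of_mul_le_mul_right h5 (by positivity)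

theorem HasIsoperimetricDimension.maxDegree_pos (hG : G.HasIsoperimetricDimension δ c)
    (hc : 0 < c) (hδ : 0 < δ) [Nonempty V] : 0 < G.maxDegree :=
  let ⟨u⟩ := ‹Nonempty V›
  pos_of_mul_pos_left (hc.trans_le (hG.le_maxDegree_mul hδ u))
    (Real.rpow_nonneg (G.μ_pos u).le _)

theorem HasIsoperimetricDimension.card_div_vol_le (hG : G.HasIsoperimetricDimension δ c)
    (hc : 0 < c) (hδ : 0 < δ) [Nonempty V] :
    (Fintype.card V : ℝ) / G.vol Finset.univ ≤ (G.maxDegree / c) ^ δ := by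
  have hd := hG.maxDegree_pos hc hδ
  have hvol : 0 < G.vol Finset.univ := Finset.sum_pos (fun u _ => G.μ_pos u) Finset.univ_nonempty
  rw [div_le_iff₀ hvol, vol, Finset.mul_sum]
  have h : ∀ u, 1 ≤ (G.maxDegree / c) ^ δ * G.μ u := by
    intro u
    have hμ := G.μ_pos u
    have h1 : 1 ≤ G.maxDegree / c * G.μ u ^ (1 / δ) := by
      rw [div_mul_eq_mul_div, le_div_iff₀ hc, one_mul]
      exact hG.le_maxDegree_mul hδ u
    calc (1 : ℝ) ≤ (G.maxDegree / c * G.μ u ^ (1 / δ)) ^ δ := Real.one_le_rpow h1 hδ.le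
      _ = (G.maxDegree / c) ^ δ * G.μ u := by
        rw [Real.mul_rpow (by positivity) (by positivity), ← Real.rpow_mul hμ.le,
          one_div_mul_cancel hδ.ne', Real.rpow_one]
  simpa using Finset.sum_le_sum fun u (_ : u ∈ Finset.univ) => h u

theorem HasIsoperimetricDimension.rpow_mul_le_one (hG : G.HasIsoperimetricDimension δ c)
    (hc : 0 < c) (hΓ : IsSignatureGroup Γ) (hδ : 2 < δ) (hd : 0 < G.maxDegree)
    (k : Fin (Fintype.card V)) (hk : G.eigenvalue k ≤ G.maxDegree) {n : ℕ} (hn : 0 < n) :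
    ((((k : ℕ) : ℝ) + 1) / G.vol Finset.univ) ^ (2 / δ) *
      ((1 - G.eigenvalue k / (2 * G.maxDegree)) ^ (2 * n)) ^ (2 / δ) *
      (2 / δ * (c ^ 2 / (32 * (1 + δ / (δ - 2)) ^ 2 * G.maxDegree ^ 2)) * n) ≤ 1 := by
  have : Nonempty V := Fintype.card_pos_iff.mp k.pos
  have hvol : 0 < G.vol Finset.univ := Finset.sum_pos (fun u _ => G.μ_pos u) Finset.univ_nonempty
  have hδ0 : 0 < δ := by linarith
  have hδ2 : 0 < δ - 2 := by linarith
  have hs : 0 < 1 + δ / (δ - 2) := by positivity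
  have hn' : (0 : ℝ) < n := by exact_mod_cast hn
  have h := hG.sum_eigenvalue_pow_le hc hΓ hδ hd hn
  set K := 2 / δ * (c ^ 2 / (32 * (1 + δ / (δ - 2)) ^ 2 * G.maxDegree ^ 2)) with hK
  have hK0 : 0 < K := by positivity
  set x := (1 - G.eigenvalue k / (2 * G.maxDegree)) with hx
  have hx0 : 0 ≤ x := by
    rw [hx, sub_nonneg, div_le_one (by linarith)]
    linarith
  have h1 : (((k : ℕ) : ℝ) + 1) * x ^ (2 * n) ≤
      ∑ k, (1 - G.eigenvalue k / (2 * G.maxDegree)) ^ (2 * n) := by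
    calc (((k : ℕ) : ℝ) + 1) * x ^ (2 * n) = ∑ i ∈ Finset.Iic k, x ^ (2 * n) := by
          rw [Finset.sum_const, Fin.card_Iic, nsmul_eq_mul]
          push_cast
          ring
      _ ≤ ∑ i ∈ Finset.Iic k, (1 - G.eigenvalue i / (2 * G.maxDegree)) ^ (2 * n) := by
          refine Finset.sum_le_sum fun i hi => pow_le_pow_left₀ hx0 ?_ _
          have := G.eigenvalue_monotone (Finset.mem_Iic.mp hi)
          rw [hx]
          gcongr
      -- The even exponent makes the dropped terms nonnegative, so no upper bound on the spectrum is
      -- needed.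
      _ ≤ _ := Finset.sum_le_sum_of_subset_of_nonneg (Finset.subset_univ _)
          fun i _ _ => (even_two_mul n).pow_nonneg _
  have h2 : (((k : ℕ) : ℝ) + 1) / G.vol Finset.univ * x ^ (2 * n) ≤ (1 / (K * n)) ^ (δ / 2) := by
    rw [div_mul_eq_mul_div, div_le_iff₀ hvol, mul_comm _ (G.vol _)]
    exact h1.trans h
  rw [← Real.mul_rpow (by positivity) (by positivity), ← le_div_iff₀ (by positivity)]
  refine (Real.rpow_le_rpow (by positivity) h2 (by positivity)).trans_eq ?_
  rw [← Real.rpow_mul (by positivity)]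
  have : δ / 2 * (2 / δ) = 1 := by field_simp
  rw [this, Real.rpow_one]

theorem exp_neg_le_one_sub_half {x : ℝ} (h0 : 0 ≤ x) (h1 : x ≤ 1) :
    Real.exp (-x) ≤ 1 - x / 2 := by
  rw [Real.exp_neg, inv_le_iff_one_le_mul₀ (Real.exp_pos x)]
  have := Real.add_one_le_exp x
  nlinarith

theorem HasIsoperimetricDimension.mul_rpow_le_eigenvalue (hG : G.HasIsoperimetricDimension δ c)
    (hc : 0 < c) (hΓ : IsSignatureGroup Γ) (hδ : 2 < δ) (k : Fin (Fintype.card V)) :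
    min (2 / δ * (c ^ 2 / (32 * (1 + δ / (δ - 2)) ^ 2 * G.maxDegree ^ 2)) * G.maxDegree *
        Real.exp (-4)) (c ^ 2 / G.maxDegree) *
      ((((k : ℕ) : ℝ) + 1) / G.vol Finset.univ) ^ (2 / δ) ≤ G.eigenvalue k := by
  have : Nonempty V := Fintype.card_pos_iff.mp k.pos
  have hvol : 0 < G.vol Finset.univ := Finset.sum_pos (fun u _ => G.μ_pos u) Finset.univ_nonempty
  have hδ0 : 0 < δ := by linarith
  have hδ2 : 0 < δ - 2 := by linarith
  have hd := hG.maxDegree_pos hc hδ0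
  have hs : 0 < 1 + δ / (δ - 2) := by positivity
  have hθ : 2 / δ ≤ 1 := by rw [div_le_one hδ0]; exact hδ.le
  have hkey := fun h n => hG.rpow_mul_le_one hc hΓ hδ hd k h (n := n)
  set K := 2 / δ * (c ^ 2 / (32 * (1 + δ / (δ - 2)) ^ 2 * G.maxDegree ^ 2)) with hK
  have hK0 : 0 < K := by positivity
  set κ := (((k : ℕ) : ℝ) + 1) / G.vol Finset.univ with hκ
  have hκ0 : 0 < κ := by positivity
  set d := G.maxDegree with hdd
  set l := G.eigenvalue k with hl
  have hκθ : 0 < κ ^ (2 / δ) := by positivity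
  -- For `l > d` the volume bound suffices and gives the constant `c ^ 2 / d`; otherwise the trace
  -- bound is used.
  rcases lt_or_ge d l with hdl | hdl
  · have h1 : κ ≤ (d / c) ^ δ := by
      refine le_trans ?_ (hG.card_div_vol_le hc hδ0)
      rw [hκ]
      gcongr
      exact_mod_cast k.isLt
    have h2 : κ ^ (2 / δ) ≤ (d / c) ^ 2 := by
      refine (Real.rpow_le_rpow hκ0.le h1 (by positivity)).trans_eq ?_
      rw [← Real.rpow_mul (by positivity), mul_div_cancel₀ _ hδ0.ne', Real.rpow_two]
    calc _ ≤ c ^ 2 / d * (d / c) ^ 2 :=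
          mul_le_mul (min_le_right _ _) h2 hκθ.le (by positivity)
      _ = d := by field_simp
      _ ≤ l := hdl.le
  · have hkey' := hkey hdl
    -- If `l ≤ 0`, the powers do not decay and the trace bound fails for large `n`.
    have hl0 : 0 < l := by
      by_contra hl0
      rw [not_lt] at hl0
      obtain ⟨n, hn⟩ := exists_nat_gt (1 / (κ ^ (2 / δ) * K))
      have hn0 : (0 : ℝ) < n := lt_trans (by positivity) hn
      have h1 := hkey' n (by exact_mod_cast hn0)
      have h2 : 1 ≤ ((1 - l / (2 * d)) ^ (2 * n)) ^ (2 / δ) := by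
        refine Real.one_le_rpow (one_le_pow₀ ?_) (by positivity)
        have : l / (2 * d) ≤ 0 := div_nonpos_of_nonpos_of_nonneg hl0 (by linarith)
        linarith
      rw [div_lt_iff₀ (by positivity)] at hn
      have h3 : κ ^ (2 / δ) * 1 * (K * n) ≤ 1 := le_trans (by gcongr) h1
      linarith
    have hdl1 : 1 ≤ d / l := (one_le_div hl0).mpr hdl
    -- The relaxation time. With `n * (l / d) ≤ 2` and `2 / δ ≤ 1`, the power below stays above `exp
    -- (-4)`.
    set n := ⌈d / l⌉₊ with hn
    have hn1 : d / l ≤ n := Nat.le_ceil _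
    have hn2 : n ≤ 2 * (d / l) := by
      have := Nat.ceil_lt_add_one (a := d / l) (by positivity)
      linarith
    have hn0 : 0 < n := Nat.ceil_pos.mpr (by positivity)
    have h1 := hkey' n hn0
    have h2 : Real.exp (-4) ≤ ((1 - l / (2 * d)) ^ (2 * n)) ^ (2 / δ) := by
      have e1 : Real.exp (-(l / d)) ≤ 1 - l / (2 * d) := by
        refine (exp_neg_le_one_sub_half (by positivity) ((div_le_one hd).mpr hdl)).trans_eq ?_
        field_simp
      have e2 : (n : ℝ) * (l / d) ≤ 2 := by
        calc (n : ℝ) * (l / d) ≤ 2 * (d / l) * (l / d) := by gcongr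
          _ = 2 := by field_simp
      have e3 : 0 ≤ (n : ℝ) * (l / d) := by positivity
      calc Real.exp (-4) ≤ Real.exp ((2 * n : ℕ) * -(l / d) * (2 / δ)) := by
            rw [Real.exp_le_exp]
            push_cast
            have : 0 < 2 / δ := by positivity
            nlinarith
        _ = (Real.exp (-(l / d)) ^ (2 * n)) ^ (2 / δ) := by
            rw [Real.exp_mul, Real.exp_nat_mul]
        _ ≤ _ := by gcongr
    have h3 : κ ^ (2 / δ) * Real.exp (-4) * (K * (d / l)) ≤ 1 := by
      refine le_trans ?_ h1
      gcongr
      exact mul_nonneg hκθ.le ((Real.exp_pos _).le.trans h2)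
    have h4 : K * d * Real.exp (-4) * κ ^ (2 / δ) ≤ l := by
      have : κ ^ (2 / δ) * Real.exp (-4) * (K * (d / l)) =
          K * d * Real.exp (-4) * κ ^ (2 / δ) / l := by ring
      rwa [this, div_le_one hl0] at h3
    exact (mul_le_mul_of_nonneg_right (min_le_left _ _) hκθ.le).trans h4

end MagneticGraph

theorem mainTheorem12 (δ : ℝ) (hδ : 2 < δ) (c : ℝ) (hc : 0 < c) (d : ℝ) :
    ∃ C : ℝ, 0 < C ∧
      ∀ (V : Type*) [Fintype V] (Γ : Subgroup Circle) (_ : IsSignatureGroup Γ)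
        (G : MagneticGraph V Γ),
        G.maxDegree = d → G.HasIsoperimetricDimension δ c →
          ∀ k : Fin (Fintype.card V),
            C * ((((k : ℕ) : ℝ) + 1) / G.vol Finset.univ) ^ (2 / δ) ≤ G.eigenvalue k ∧
            C * ((((k : ℕ) : ℝ) + 1) / G.vol Finset.univ) ≤ G.eigenvalue k := by
  have hδ0 : 0 < δ := by linarith
  have hδ2 : 0 < δ - 2 := by linarith
  -- Isoperimetry forces a positive maximal degree on a nonempty vertex set, so `d ≤ 0` is vacuous.
  rcases le_or_gt d 0 with hd | hd
  · refine ⟨1, one_pos, fun V _ Γ hΓ G hGd hG k => ?_⟩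
    have : Nonempty V := Fintype.card_pos_iff.mp k.pos
    exact absurd (hG.maxDegree_pos hc hδ0) (by rw [hGd]; exact not_lt.mpr hd)
  have hs : 0 < 1 + δ / (δ - 2) := by positivity
  set C := min (2 / δ * (c ^ 2 / (32 * (1 + δ / (δ - 2)) ^ 2 * d ^ 2)) * d * Real.exp (-4))
    (c ^ 2 / d) with hC
  have hC0 : 0 < C := lt_min (by positivity) (by positivity)
  -- This bounds `κ ^ (1 - 2 / δ)`, because `κ ≤ (d / c) ^ δ`.
  set B := (d / c) ^ (δ - 2) with hB
  have hB0 : 0 < B := by positivity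
  refine ⟨min C (C / B), lt_min hC0 (div_pos hC0 hB0), fun V _ Γ hΓ G hGd hG k => ?_⟩
  have : Nonempty V := Fintype.card_pos_iff.mp k.pos
  have hvol : 0 < G.vol Finset.univ := Finset.sum_pos (fun u _ => G.μ_pos u) Finset.univ_nonempty
  have h1 := hG.mul_rpow_le_eigenvalue hc hΓ hδ k
  have h2 : (((k : ℕ) : ℝ) + 1) / G.vol Finset.univ ≤ (d / c) ^ δ := by
    have := hG.card_div_vol_le hc hδ0
    rw [hGd] at this
    refine le_trans ?_ this
    gcongr
    exact_mod_cast k.isLt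
  rw [hGd, ← hC] at h1
  set κ := (((k : ℕ) : ℝ) + 1) / G.vol Finset.univ with hκ
  have hκ0 : 0 < κ := by positivity
  refine ⟨(mul_le_mul_of_nonneg_right (min_le_left _ _) (by positivity)).trans h1,
    (mul_le_mul_of_nonneg_right (min_le_right _ _) hκ0.le).trans (le_trans ?_ h1)⟩
  have hθ : 0 ≤ 1 - 2 / δ := by
    rw [sub_nonneg, div_le_one hδ0]
    exact hδ.le
  have h3 : κ ^ (1 - 2 / δ) ≤ B := by
    refine (Real.rpow_le_rpow hκ0.le h2 hθ).trans_eq ?_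
    rw [← Real.rpow_mul (by positivity), hB]
    congr 1
    field_simp
  have h4 : κ = κ ^ (2 / δ) * κ ^ (1 - 2 / δ) := by
    rw [← Real.rpow_add hκ0, add_sub_cancel, Real.rpow_one]
  calc C / B * κ = C / B * (κ ^ (2 / δ) * κ ^ (1 - 2 / δ)) := by rw [← h4]
    _ ≤ C / B * (κ ^ (2 / δ) * B) := by gcongr
    _ = C * κ ^ (2 / δ) := by field_simp
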